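/- Notation. Let $\mathbb{R}_+=(0,\infty)$, and let $\mathcal{F}$ be the unitary Fourier transformation on $L^2(\mathbb{R})$, $(\mathcal{F}^{-1}f)(x)=(2\pi)^{-1/2}\int e^{ixy}f(y)\,dy$ for $f\in L^1\cap L^2$. Let $P_+:L^2(\mathbb{R})\to L^2(\mathbb{R}_+)$ be the restriction map and $P_+^*$ its adjoint (extension by $0$). Let $\mathbb{T}$ be the unit circle with normalized Lebesgue measure, $e_n(z)=z^n$, let $H^2(\mathbb{T})$ be the closed span of $\{e_n:n\ge 0\}$ in $L^2(\mathbb{T})$, and let $Q_+:L^2(\mathbb{T})\to H^2(\mathbb{T})$ be the orthogonal projection. For $\omega\in L^\infty$ let $M(\omega)$ be the operator of multiplication by $\omega$ on the corresponding $L^2$ space, and for $\omega\in L^\infty(\mathbb{T})$ let $T(\omega)=Q_+M(\omega)Q_+^*$ be the Toeplitz operator on $H^2(\mathbb{T})$. For $0<s<1$ and $x>0$ put $$q_+(s,x)=\tfrac12\pi^{-3/2}s^{-1}(1-s)^{-1/2}\int_{-1}^1 e^{-ixu}(1-u^2)^{-1/2}\exp\Big(\tfrac{i}{2\pi}\ln\big(\tfrac1s-1\big)\ln\tfrac{1-u}{1+u}\Big)du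 ,$$ and let $(Vh)(x)=\operatorname{l.i.m.}_{a,a'\downarrow 0}\int_a^{1-a'}q_+(s,x)h(s)\,ds$ for $h\in L^2(0,1)$, where l.i.m. denotes the limit in $L^2(\mathbb{R}_+)$. For $\alpha\in[0,2\pi)$ and $\beta\in(0,\pi)$ put $\delta=\tan(\beta/2)$, let $A=\{e^{i\varphi}:\alpha+\beta\le\varphi\le\alpha+2\pi-\beta\}$, and let $X_+=Q_+X\mathcal{F}^{-1}P_+^*:L^2(\mathbb{R}_+)\to H^2(\mathbb{T})$, where $X:L^2(\mathbb{R})\to L^2(\mathbb{T})$ is $$(Xf)(z)=(2\pi)^{1/2}e^{i\alpha}\frac{\sqrt{2\delta}}{-z+e^{i\alpha}}\,f\big(\chi^{-1}(z)\big),\qquad \chi^{-1}(z)=i\delta\,\frac{z+e^{i\alpha}}{-z+e^{i\alpha}} .$$ Let $P_n^{(1/2)}(x;\beta)$, $n\ge0$, be the Meixner–Pollaczek polynomials, with generating function $\sum_n P_n^{(1/2)}(x;\beta)q^n=(1-qe^{i\beta})^{-1/2+ix}(1-qe^{-i\beta})^{-1/2-ix}$, and for $0<s<1$ put $$h_n(s)=e^{in\alpha}\Big(\frac{\sin\beta}{\pi}\Big)^{1/2}\Big(\frac1s-1\Big)^{\beta/(2\pi)}(1-s)^{-1/2}\,P_n^{(1/2)}\Big(\tfrac1{2\pi}\ln\big(\tfrac1s-1\big);\beta\Big).$$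 Let $l_n$, $n\ge0$, be the Laguerre functions on $\mathbb{R}_+$, with generating function $\sum_n l_n(x)q^n=(1-q)^{-1}\exp\big(-\tfrac12\tfrac{1+q}{1-q}x\big)$. **Theorem.** The map $V$ is well defined and is a Hilbert space isomorphism from $L^2(0,1)$ onto $L^2(\mathbb{R}_+)$. For all $\alpha\in[0,2\pi)$ and $\beta\in(0,\pi)$, the map $Y=X_+V$ is a Hilbert space isomorphism from $L^2(0,1)$ onto $H^2(\mathbb{T})$ that diagonalizes $T(1_A)$, that is, $T(1_A)=Y\,M(\mathrm{id})\,Y^{-1}$ with $\mathrm{id}(s)=s$; the functions $h_n$, $n\ge0$, form an orthonormal basis of $L^2(0,1)$; and $$Y^{-1}e_n=h_n\qquad(n\ge0).$$ In particular, if $\alpha=0$ and $\tan(\beta/2)=\tfrac12$, then $V^{-1}l_n=h_n$ for all $n\ge 0$. -/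

import Mathlib

open MeasureTheory Set Filter Topology Complex
open scoped Real ENNReal

noncomputable section

namespace ArcToeplitz

/-! ### The Hilbert spaces -/

/-- `L²(0,1)`. -/
abbrev L2Unit : Type := Lp ℂ 2 (volume.restrict (Ioo (0 : ℝ) 1))

/-- `L²(ℝ₊)` with `ℝ₊ = (0,∞)`. -/
abbrev L2Pos : Type := Lp ℂ 2 (volume.restrict (Ioi (0 : ℝ)))

/-- `L²(ℝ)`. -/
abbrev L2Real : Type := Lp ℂ 2 (volume : Measure ℝ)

instance fact_two_pi_pos : Fact ((0 : ℝ) < 2 * π) := ⟨Real.two_pi_pos⟩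

/-- The unit circle `𝕋`, parametrised as `ℝ/2πℤ` by `θ ↦ exp (iθ)`. -/
abbrev Torus : Type := AddCircle (2 * π)

/-- The normalized Lebesgue measure on `𝕋`. -/
abbrev torusMeasure : Measure Torus := AddCircle.haarAddCircle

/-- `L²(𝕋)`. -/
abbrev L2Torus : Type := Lp ℂ 2 torusMeasure

/-- The point `z = exp (iθ)` of the unit circle in `ℂ` given by the class `θ`. -/
def torusPoint (θ : Torus) : ℂ := (AddCircle.toCircle θ : ℂ)

/-- The Hardy space `H²(𝕋)`: the closed span in `L²(𝕋)` of the functions `z ↦ z ^ n`, `n ≥ 0`. -/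
def hardy : Submodule ℂ L2Torus :=
  (Submodule.span ℂ (range fun n : ℕ => (fourierLp 2 (n : ℤ) : L2Torus))).topologicalClosure

instance completeSpace_hardy : CompleteSpace hardy :=
  (Submodule.isClosed_topologicalClosure _).completeSpace_coe

/-- The standard basis element `e_n`, `e_n(z) = z ^ n`, of `H²(𝕋)`. -/
def hardyBasis (n : ℕ) : hardy :=
  ⟨fourierLp 2 (n : ℤ), Submodule.le_topologicalClosure _ (Submodule.subset_span ⟨n, rfl⟩)⟩

/-! ### Multiplication operators and Toeplitz operators -/

/-- The multiplication operator `M(ω)` on `L²(μ)` for `ω ∈ L^∞(μ)`. -/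
def mulOp {E : Type*} [MeasurableSpace E] {μ : Measure E} (ω : Lp ℂ ∞ μ) :
    Lp ℂ 2 μ →L[ℂ] Lp ℂ 2 μ :=
  (ContinuousLinearMap.mul ℂ ℂ).holderL μ ∞ 2 2 ω

/-- The Toeplitz operator `T(ω) = Q₊ M(ω) Q₊*` on `H²(𝕋)`, where `Q₊ : L²(𝕋) → H²(𝕋)` is the
orthogonal projection and `Q₊*` is the inclusion. -/
def toeplitz (ω : Lp ℂ ∞ torusMeasure) : hardy →L[ℂ] hardy :=
  hardy.orthogonalProjectionOnto ∘L mulOp ω ∘L hardy.subtypeL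

/-- The arc `A = {exp (iφ) : α + β ≤ φ ≤ α + 2π - β}`. -/
def arc (α β : ℝ) : Set Torus :=
  (fun φ : ℝ => (φ : Torus)) '' Icc (α + β) (α + 2 * π - β)

theorem measurableSet_arc (α β : ℝ) : MeasurableSet (arc α β) :=
  (isCompact_Icc.image (AddCircle.continuous_mk' (2 * π))).isClosed.measurableSet

/-- The indicator function `1_A` of the arc, as an element of `L^∞(𝕋)`. -/
def arcIndicator (α β : ℝ) : Lp ℂ ∞ torusMeasure :=
  indicatorConstLp ∞ (measurableSet_arc α β) (measure_ne_top _ _) 1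

theorem memLp_id_unit :
    MemLp (fun s : ℝ => (s : ℂ)) ∞ (volume.restrict (Ioo (0 : ℝ) 1)) := by
  refine memLp_top_of_bound Complex.continuous_ofReal.aestronglyMeasurable 1 ?_
  filter_upwards [ae_restrict_mem measurableSet_Ioo] with s hs
  rw [Complex.norm_real, Real.norm_eq_abs, abs_of_pos hs.1]
  exact hs.2.le

/-- The function `s ↦ s` as an element of `L^∞(0,1)`. -/
def idUnit : Lp ℂ ∞ (volume.restrict (Ioo (0 : ℝ) 1)) := memLp_id_unit.toLp _

/-! ### Weighted composition operators between `L²` spaces -/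

section WeightedComp

variable {E F : Type*} [MeasurableSpace E] [MeasurableSpace F] {μ : Measure E} {ν : Measure F}
  {w : E → ℂ} {T : E → F}

theorem eLpNorm_weightedComp (hw : Measurable w) (hT : Measurable T)
    (h : (μ.withDensity fun x => ‖w x‖ₑ ^ 2).map T = ν) {f : F → ℂ} (hf : StronglyMeasurable f) :
    eLpNorm (fun x => w x * f (T x)) 2 μ = eLpNorm f 2 ν := by
  rw [eLpNorm_eq_lintegral_rpow_enorm_toReal two_ne_zero ENNReal.ofNat_ne_top,
    eLpNorm_eq_lintegral_rpow_enorm_toReal two_ne_zero ENNReal.ofNat_ne_top, ← h,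
    lintegral_map (hf.measurable.enorm.pow_const _) hT,
    lintegral_withDensity_eq_lintegral_mul _ (hw.enorm.pow_const 2)
      (g := fun x => ‖f (T x)‖ₑ ^ ENNReal.toReal 2)
      ((hf.measurable.comp hT).enorm.pow_const _)]
  congr 2
  funext x
  simp [enorm_mul, mul_pow]

theorem memLp_weightedComp (hw : Measurable w) (hT : Measurable T)
    (h : (μ.withDensity fun x => ‖w x‖ₑ ^ 2).map T = ν) (f : Lp ℂ 2 ν) :
    MemLp (fun x => w x * f (T x)) 2 μ :=
  ⟨(hw.stronglyMeasurable.mul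
      ((Lp.stronglyMeasurable f).comp_measurable hT)).aestronglyMeasurable, by
    rw [eLpNorm_weightedComp hw hT h (Lp.stronglyMeasurable f)]
    exact Lp.eLpNorm_lt_top f⟩

theorem weightedComp_congr (hw : Measurable w) (hT : Measurable T)
    (h : (μ.withDensity fun x => ‖w x‖ₑ ^ 2).map T = ν) {f g : F → ℂ} (hfg : f =ᵐ[ν] g) :
    (fun x => w x * f (T x)) =ᵐ[μ] fun x => w x * g (T x) := by
  rw [← h] at hfg
  have h1 := ae_of_ae_map hT.aemeasurable hfg
  rw [ae_withDensity_iff (by fun_prop)] at h1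
  filter_upwards [h1] with x hx
  by_cases h0 : w x = 0
  · simp [h0]
  · rw [hx (by simpa using h0)]

/-- The isometry `L²(ν) → L²(μ)`, `f ↦ w · (f ∘ T)`, where `ν` is the image under `T` of the
measure with density `|w|²` with respect to `μ`. -/
def weightedComp (hw : Measurable w) (hT : Measurable T)
    (h : (μ.withDensity fun x => ‖w x‖ₑ ^ 2).map T = ν) : Lp ℂ 2 ν →ₗᵢ[ℂ] Lp ℂ 2 μ where
  toFun f := (memLp_weightedComp hw hT h f).toLp _
  map_add' f g := by
    rw [← MemLp.toLp_add]
    refine MemLp.toLp_congr _ _ ((weightedComp_congr hw hT h (Lp.coeFn_add f g)).trans ?_)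
    exact .of_forall fun x => by simp [mul_add]
  map_smul' c f := by
    rw [RingHom.id_apply, ← MemLp.toLp_const_smul]
    refine MemLp.toLp_congr _ _ ((weightedComp_congr hw hT h (Lp.coeFn_smul c f)).trans ?_)
    exact .of_forall fun x => by simp [mul_left_comm]
  norm_map' f := by
    change ‖(memLp_weightedComp hw hT h f).toLp _‖ = ‖f‖
    rw [Lp.norm_toLp, eLpNorm_weightedComp hw hT h (Lp.stronglyMeasurable f), Lp.norm_def]

end WeightedComp

/-! ### The Fourier transformation -/

theorem dilation_map :
    ((volume : Measure ℝ).withDensity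
      fun _ => ‖(((2 * π) ^ (-(1 / 2 : ℝ)) : ℝ) : ℂ)‖ₑ ^ 2).map (fun x : ℝ => x / (2 * π))
      = volume := by
  have hp : (0 : ℝ) < 2 * π := Real.two_pi_pos
  have e1 : ‖(((2 * π) ^ (-(1 / 2 : ℝ)) : ℝ) : ℂ)‖ₑ ^ 2 = ENNReal.ofReal (2 * π)⁻¹ := by
    rw [← ofReal_norm, Complex.norm_real, Real.norm_eq_abs,
      abs_of_pos (Real.rpow_pos_of_pos hp _), ← ENNReal.ofReal_pow (Real.rpow_pos_of_pos hp _).le,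
      ← Real.rpow_natCast, ← Real.rpow_mul hp.le]
    norm_num [Real.rpow_neg_one]
  rw [e1, withDensity_const, Measure.map_smul]
  have e2 := Real.map_volume_mul_right (a := (2 * π)⁻¹) (by positivity)
  simp only [← div_eq_mul_inv] at e2
  rw [e2, smul_smul, ← ENNReal.ofReal_mul (by positivity), inv_inv, abs_of_pos hp,
    inv_mul_cancel₀ hp.ne', ENNReal.ofReal_one, one_smul]

/-- The inverse Fourier transformation on `L²(ℝ)` in the normalization
`(𝓕⁻¹ f)(x) = (2π)^(-1/2) ∫ exp (ixy) f(y) dy` for `f ∈ L¹ ∩ L²`. It is obtained from the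
transformation `g(x) = ∫ exp (2πixy) f(y) dy` as `x ↦ (2π)^(-1/2) g(x/(2π))`. -/
def fourierInv : L2Real →L[ℂ] L2Real :=
  (weightedComp (μ := volume) (w := fun _ => (((2 * π) ^ (-(1 / 2 : ℝ)) : ℝ) : ℂ))
      (T := fun x : ℝ => x / (2 * π)) measurable_const (measurable_id.div_const _)
      dilation_map).toContinuousLinearMap ∘L
    ((Lp.fourierTransformₗᵢ ℝ ℂ).symm : L2Real →L[ℂ] L2Real)

/-! ### The isomorphisms `X` and `X₊` -/

/-- The inverse `χ⁻¹(z) = iδ (z + exp (iα)) / (-z + exp (iα))` of the Möbius transformation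
`χ(x) = exp (iα) (x - iδ) / (x + iδ)`. It is real for `z` on the unit circle. -/
def moebiusInv (α δ : ℝ) (z : ℂ) : ℂ :=
  I * δ * (z + exp (I * α)) / (-z + exp (I * α))

/-- The factor `(2π)^(1/2) exp (iα) √(2δ) / (-z + exp (iα))` in the definition of `X`. -/
def moebiusWeight (α δ : ℝ) (z : ℂ) : ℂ :=
  (√(2 * π) : ℂ) * exp (I * α) * ((√(2 * δ) : ℂ) / (-z + exp (I * α)))

theorem measurable_torusPoint : Measurable torusPoint :=
  (continuous_subtype_val.comp AddCircle.continuous_toCircle).measurable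

theorem measurable_moebiusInv (α δ : ℝ) :
    Measurable fun θ : Torus => (moebiusInv α δ (torusPoint θ)).re := by
  have := measurable_torusPoint
  unfold moebiusInv
  fun_prop

theorem measurable_moebiusWeight (α δ : ℝ) :
    Measurable fun θ : Torus => moebiusWeight α δ (torusPoint θ) := by
  have := measurable_torusPoint
  unfold moebiusWeight
  fun_prop

theorem torusPoint_coe (α t : ℝ) :
    torusPoint (t : Torus) =
      -(exp (I * α) * exp (2 * ((((t - α - π) / 2 : ℝ) : ℂ) * I))) := by
  rw [torusPoint, AddCircle.toCircle_apply_mk, Circle.coe_exp, ← Complex.exp_add]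
  have h1 : (((2 * π / (2 * π) * t : ℝ) : ℂ)) * I =
      I * α + 2 * ((((t - α - π) / 2 : ℝ) : ℂ) * I) + π * I := by
    rw [div_self Real.two_pi_pos.ne']
    push_cast
    ring
  rw [h1, Complex.exp_add_pi_mul_I]

theorem one_add_exp_two_mul (c : ℝ) :
    1 + exp (2 * ((c : ℂ) * I)) = 2 * (Real.cos c : ℂ) * exp ((c : ℂ) * I) := by
  rw [Complex.ofReal_cos, Complex.two_cos, two_mul, Complex.exp_add, add_mul,
    ← Complex.exp_add (-(c : ℂ) * I)]
  simp [add_comm]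

theorem one_sub_exp_two_mul (c : ℝ) :
    1 - exp (2 * ((c : ℂ) * I)) = -(2 * I * (Real.sin c : ℂ)) * exp ((c : ℂ) * I) := by
  have h : 2 * I * (Real.sin c : ℂ) = exp ((c : ℂ) * I) - exp (-(c : ℂ) * I) := by
    rw [Complex.ofReal_sin]
    have := Complex.two_sin (c : ℂ)
    linear_combination I * this + (exp (-(c : ℂ) * I) - exp ((c : ℂ) * I)) * Complex.I_mul_I
  rw [h, two_mul, Complex.exp_add, neg_mul, sub_mul, ← Complex.exp_add (-(c : ℂ) * I)]
  simp

theorem moebiusInv_torusPoint {α δ t : ℝ} (hc : Real.cos ((t - α - π) / 2) ≠ 0) :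
    (moebiusInv α δ (torusPoint (t : Torus))).re = δ * Real.tan ((t - α - π) / 2) := by
  rw [moebiusInv, torusPoint_coe]
  set c := (t - α - π) / 2
  have hc' : (Real.cos c : ℂ) ≠ 0 := by exact_mod_cast hc
  have e1 := one_add_exp_two_mul c
  have e2 := one_sub_exp_two_mul c
  have h1 := Complex.exp_ne_zero (I * α)
  have h2 := Complex.exp_ne_zero ((c : ℂ) * I)
  have n1 : -(exp (I * α) * exp (2 * ((c : ℂ) * I))) + exp (I * α) =
      exp (I * α) * (-(2 * I * (Real.sin c : ℂ)) * exp ((c : ℂ) * I)) := by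
    rw [← e2]; ring
  have n2 : -(-(exp (I * α) * exp (2 * ((c : ℂ) * I)))) + exp (I * α) =
      exp (I * α) * (2 * (Real.cos c : ℂ) * exp ((c : ℂ) * I)) := by
    rw [← e1]; ring
  have n3 : I * δ * (exp (I * α) * (-(2 * I * (Real.sin c : ℂ)) * exp ((c : ℂ) * I))) /
      (exp (I * α) * (2 * (Real.cos c : ℂ) * exp ((c : ℂ) * I))) =
      ((δ * Real.tan c : ℝ) : ℂ) := by
    rw [Real.tan_eq_sin_div_cos, div_eq_iff
      (mul_ne_zero h1 (mul_ne_zero (mul_ne_zero two_ne_zero hc') h2))]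
    push_cast at hc' ⊢
    field_simp
    linear_combination -((δ : ℂ) * Complex.sin c) * Complex.I_sq
  rw [n1, n2, n3, Complex.ofReal_re]

theorem enorm_moebiusWeight (α : ℝ) {δ t : ℝ} (hδ : 0 < δ)
    (hc : Real.cos ((t - α - π) / 2) ≠ 0) :
    ‖moebiusWeight α δ (torusPoint (t : Torus))‖ₑ ^ 2 =
      ENNReal.ofReal (2 * π * (δ / (2 * Real.cos ((t - α - π) / 2) ^ 2))) := by
  rw [moebiusWeight, torusPoint_coe]
  set c := (t - α - π) / 2
  have e1 := one_add_exp_two_mul c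
  have n2 : -(-(exp (I * α) * exp (2 * ((c : ℂ) * I)))) + exp (I * α) =
      exp (I * α) * (2 * (Real.cos c : ℂ) * exp ((c : ℂ) * I)) := by
    rw [← e1]; ring
  have a1 : ‖exp (I * α)‖ = 1 := by rw [mul_comm, Complex.norm_exp_ofReal_mul_I]
  rw [n2, ← ofReal_norm, ← ENNReal.ofReal_pow (norm_nonneg _)]
  congr 1
  rw [norm_mul, norm_mul, norm_div, norm_mul, norm_mul, norm_mul, a1,
    Complex.norm_exp_ofReal_mul_I, Complex.norm_real, Complex.norm_real, Complex.norm_real,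
    Real.norm_eq_abs, Real.norm_eq_abs, Real.norm_eq_abs, Complex.norm_two]
  simp only [mul_one, one_mul, mul_pow, div_pow, sq_abs]
  rw [Real.sq_sqrt (by positivity), Real.sq_sqrt (by positivity)]
  field_simp

theorem moebius_map (α : ℝ) {δ : ℝ} (hδ : 0 < δ) :
    ((torusMeasure.withDensity fun θ => ‖moebiusWeight α δ (torusPoint θ)‖ₑ ^ 2).map
      fun θ => (moebiusInv α δ (torusPoint θ)).re) = volume := by
  have hp : (0 : ℝ) < 2 * π := Real.two_pi_pos
  ext B hB
  rw [Measure.map_apply (measurable_moebiusInv α δ) hB,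
    withDensity_apply _ (measurable_moebiusInv α δ hB),
    ← lintegral_indicator (measurable_moebiusInv α δ hB)]
  set G : Torus → ℝ≥0∞ := ((fun θ => (moebiusInv α δ (torusPoint θ)).re) ⁻¹' B).indicator
    fun θ => ‖moebiusWeight α δ (torusPoint θ)‖ₑ ^ 2 with hG
  have hGm : Measurable G :=
    ((measurable_moebiusWeight α δ).enorm.pow_const 2).indicator (measurable_moebiusInv α δ hB)
  have e1 : ENNReal.ofReal (2 * π) * ∫⁻ θ, G θ ∂torusMeasure
      = ∫⁻ t in Ioo α (α + 2 * π), G (t : Torus) := by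
    rw [Measure.restrict_congr_set Ioo_ae_eq_Ioc,
      (AddCircle.measurePreserving_mk (2 * π) α).lintegral_comp hGm,
      AddCircle.volume_eq_smul_haarAddCircle, lintegral_smul_measure, smul_eq_mul]
  have key : ∀ t ∈ Ioo α (α + 2 * π), G (t : Torus) = ENNReal.ofReal (2 * π) *
      (ENNReal.ofReal |δ * (1 / Real.cos ((t - α - π) / 2) ^ 2 * (1 / 2))| *
        B.indicator (fun _ => (1 : ℝ≥0∞)) (δ * Real.tan ((t - α - π) / 2))) := by
    intro t ht
    have hc : 0 < Real.cos ((t - α - π) / 2) := Real.cos_pos_of_mem_Ioo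
      ⟨by linarith [ht.1], by linarith [ht.2]⟩
    by_cases hmem : δ * Real.tan ((t - α - π) / 2) ∈ B
    · have hm : (t : Torus) ∈ (fun θ => (moebiusInv α δ (torusPoint θ)).re) ⁻¹' B := by
        simpa only [Set.mem_preimage, moebiusInv_torusPoint hc.ne'] using hmem
      rw [hG, Set.indicator_of_mem hm, Set.indicator_of_mem hmem, mul_one,
        enorm_moebiusWeight α hδ hc.ne']
      rw [← ENNReal.ofReal_mul hp.le, abs_of_pos (by positivity)]
      congr 1
      ring
    · have hm : (t : Torus) ∉ (fun θ => (moebiusInv α δ (torusPoint θ)).re) ⁻¹' B := by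
        simpa only [Set.mem_preimage, moebiusInv_torusPoint hc.ne'] using hmem
      rw [hG, Set.indicator_of_notMem hm, Set.indicator_of_notMem hmem, mul_zero, mul_zero]
  have himg : (fun t : ℝ => δ * Real.tan ((t - α - π) / 2)) '' Ioo α (α + 2 * π) = univ := by
    refine eq_univ_of_forall fun y => ⟨2 * Real.arctan (y / δ) + α + π, ⟨?_, ?_⟩, ?_⟩
    · linarith [Real.neg_pi_div_two_lt_arctan (y / δ)]
    · linarith [Real.arctan_lt_pi_div_two (y / δ)]
    · have : (2 * Real.arctan (y / δ) + α + π - α - π) / 2 = Real.arctan (y / δ) := by ring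
      simp only [this, Real.tan_arctan]
      field_simp
  have hinj : InjOn (fun t : ℝ => δ * Real.tan ((t - α - π) / 2)) (Ioo α (α + 2 * π)) := by
    intro a ha b hb hab
    have := Real.injOn_tan (x₁ := (a - α - π) / 2) (x₂ := (b - α - π) / 2)
      ⟨by linarith [ha.1], by linarith [ha.2]⟩ ⟨by linarith [hb.1], by linarith [hb.2]⟩
      (mul_left_cancel₀ hδ.ne' hab)
    linarith
  have hder : ∀ t ∈ Ioo α (α + 2 * π), HasDerivWithinAt
      (fun t : ℝ => δ * Real.tan ((t - α - π) / 2))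
      (δ * (1 / Real.cos ((t - α - π) / 2) ^ 2 * (1 / 2))) (Ioo α (α + 2 * π)) t := by
    intro t ht
    have hc : 0 < Real.cos ((t - α - π) / 2) := Real.cos_pos_of_mem_Ioo
      ⟨by linarith [ht.1], by linarith [ht.2]⟩
    have h1 : HasDerivAt (fun t : ℝ => (t - α - π) / 2) (1 / 2) t :=
      (((hasDerivAt_id t).sub_const α).sub_const π).div_const 2
    exact (((Real.hasDerivAt_tan hc.ne').comp t h1).const_mul δ).hasDerivWithinAt
  have e2 := lintegral_image_eq_lintegral_abs_deriv_mul measurableSet_Ioo hder hinj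
    (B.indicator fun _ => (1 : ℝ≥0∞))
  rw [himg, Measure.restrict_univ, lintegral_indicator_const hB, one_mul] at e2
  rw [setLIntegral_congr_fun measurableSet_Ioo key,
    lintegral_const_mul' _ _ ENNReal.ofReal_ne_top, ← e2] at e1
  exact (ENNReal.mul_right_inj (by simpa using Real.pi_pos) ENNReal.ofReal_ne_top).1 e1

/-- The isomorphism `X : L²(ℝ) → L²(𝕋)`,
`(X f)(z) = (2π)^(1/2) exp (iα) √(2δ) / (-z + exp (iα)) · f(χ⁻¹(z))`. -/
def opX (α : ℝ) {δ : ℝ} (hδ : 0 < δ) : L2Real →L[ℂ] L2Torus :=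
  (weightedComp (measurable_moebiusWeight α δ) (measurable_moebiusInv α δ)
    (moebius_map α hδ)).toContinuousLinearMap

/-- The projection `P₊ : L²(ℝ) → L²(ℝ₊)`, the restriction of functions to `ℝ₊`. -/
def restrictPos : L2Real →L[ℂ] L2Pos :=
  LpToLpRestrictCLM ℝ ℂ ℂ volume 2 (Ioi (0 : ℝ))

/-- `X₊ = Q₊ X 𝓕⁻¹ P₊* : L²(ℝ₊) → H²(𝕋)`. -/
def opXPlus (α : ℝ) {δ : ℝ} (hδ : 0 < δ) : L2Pos →L[ℂ] hardy :=
  hardy.orthogonalProjectionOnto ∘L opX α hδ ∘L fourierInv ∘L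
    ContinuousLinearMap.adjoint restrictPos

theorem tan_half_pos {β : ℝ} (h0 : 0 < β) (h1 : β < π) : 0 < Real.tan (β / 2) :=
  Real.tan_pos_of_pos_of_lt_pi_div_two (by linarith) (by linarith)

/-! ### The isomorphism `V` -/

/-- The kernel `q₊(s,x) = ½ π^(-3/2) s⁻¹ (1-s)^(-1/2) ∫_{-1}^{1} exp (-ixu) (1-u²)^(-1/2)
exp ((i/2π) ln (1/s - 1) ln ((1-u)/(1+u))) du` for `0 < s < 1`, `x > 0`. -/
def kernelQ (s x : ℝ) : ℂ :=
  ((1 / 2 * π ^ (-(3 / 2 : ℝ)) * s⁻¹ * (1 - s) ^ (-(1 / 2 : ℝ)) : ℝ) : ℂ) *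
    ∫ u in (-1 : ℝ)..1, exp (-(I * x * u)) * (((1 - u ^ 2) ^ (-(1 / 2 : ℝ)) : ℝ) : ℂ) *
      exp (I / (2 * π) * Real.log (1 / s - 1) * Real.log ((1 - u) / (1 + u)))

/-- `g ∈ L²(ℝ₊)` is the limit in the mean of `x ↦ ∫_{a}^{1-a'} q₊(s,x) h(s) ds` as `a, a' ↓ 0`,
that is, `g` is the value at `h` of the integral transformation `V`. -/
def IsTransformV (h : L2Unit) (g : L2Pos) : Prop :=
  Tendsto (fun a : ℝ × ℝ =>
      eLpNorm (fun x : ℝ => (∫ s in a.1..(1 - a.2), kernelQ s x * h s) - g x) 2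
        (volume.restrict (Ioi (0 : ℝ))))
    (𝓝[>] (0 : ℝ) ×ˢ 𝓝[>] (0 : ℝ)) (𝓝 0)

/-! ### The orthonormal functions -/

/-- The `n`th coefficient of the power series of `f` at `0`. -/
def taylorCoeff (f : ℂ → ℂ) (n : ℕ) : ℂ := iteratedDeriv n f 0 / (n.factorial : ℂ)

/-- The Meixner-Pollaczek polynomial `P_n^{(1/2)}(x;β)`, the coefficient of `q ^ n` in
`(1 - q exp (iβ))^(-1/2 + ix) (1 - q exp (-iβ))^(-1/2 - ix)`. -/
def meixnerPollaczek (n : ℕ) (x β : ℝ) : ℂ :=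
  taylorCoeff (fun q : ℂ => (1 - q * exp (I * β)) ^ (-(1 / 2) + I * x : ℂ) *
    (1 - q * exp (-(I * β))) ^ (-(1 / 2) - I * x : ℂ)) n

/-- `h_n(s) = exp (inα) (sin β / π)^(1/2) (1/s - 1)^(β/2π) (1-s)^(-1/2)
P_n^{(1/2)}((1/2π) ln (1/s - 1); β)` for `0 < s < 1`. -/
def mpFun (α β : ℝ) (n : ℕ) (s : ℝ) : ℂ :=
  exp (I * n * α) *
    ((√(Real.sin β / π) * (1 / s - 1) ^ (β / (2 * π)) * (1 - s) ^ (-(1 / 2 : ℝ)) : ℝ) : ℂ) *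
    meixnerPollaczek n (1 / (2 * π) * Real.log (1 / s - 1)) β

/-- The Laguerre function `l_n` on `ℝ₊`, the coefficient of `q ^ n` in
`(1 - q)⁻¹ exp (-½ (1 + q) / (1 - q) x)`. -/
def laguerreFun (n : ℕ) (x : ℝ) : ℂ :=
  taylorCoeff (fun q : ℂ => (1 - q)⁻¹ * exp (-(1 / 2) * ((1 + q) / (1 - q)) * x)) n

end ArcToeplitz

end

open ArcToeplitz

/-!
The proof rests on the family of exponentials `expPos w : x ↦ exp (-wx)`, `w > 0`, in `L²(ℝ₊)`, and
on the matching family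
`kerUnit w : s ↦ π^(-1/2) (1 + w²)^(-1/2) s^(-a) (1-s)^(a-1/2)`, `a = arctan w / π`, in `L²(0,1)`.

* Both families have the Gram matrix `1 / (w + v)` (`inner_expPos_expPos` and `inner_kerLp_kerLp`,
  the latter by the reflection formula for the Gamma function), and both are total, because a
  two-sided Laplace transform that vanishes on an interval has a vanishing density
  (`ae_eq_zero_of_integral_exp_mul_eq_zero`). Hence there is exactly one unitary map `V` with
  `V (kerUnit w) = expPos w`.
* This `V` is the integral transformation with the kernel `q₊`, since `kerUnit w s` is the Laplace
  transform of `x ↦ q₊(s,x)` at `w` (`integral_exp_mul_kernelQ`). Indeed the integral in the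
  definition of `q₊` is, up to a substitution, the convolution of two complex Gamma densities. So
  for `h` supported in a compact part of `(0,1)` the integral `∫ q₊(s,x) h(s) ds` and `V h` have the
  same Laplace transform, and `isTransformV_apply` follows by continuity.
* `X₊` maps the exponentials to multiples of the geometric series `∑ (q exp (-iα))^n e_n` with
  `q = (w - δ) / (w + δ)` (`hasSum_opXPlus_expPos`). So `X 𝓕⁻¹ P₊*` takes its values in the Hardy
  space, and the totality of these series makes `X₊` unitary (`exists_linearIsometryEquiv_opXPlus`).
* The Möbius transformation carries the arc `A` to `[-1,1]`, so the matrix elements of `T(1_A)`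
  between the `X₊ expPos w` are the integrals of `1 / (2π (w + ix) (v - ix))` over `[-1,1]`. They
  agree with the matrix elements of multiplication by `s` between the `kerUnit w`, which gives the
  diagonalization (`toeplitz_eq_conj_mulOp`).
* Up to a factor, the `kerUnit w` are thus the values at `q = (w - δ) / (w + δ)` of the power series
  with the coefficients `exp (-inα) Y⁻¹ e_n`. As functions of `q` they are the generating function
  of the Meixner-Pollaczek polynomials (`smul_kerUnit_eq`, `meixnerPollaczek_generating`), and
  comparing Taylor coefficients gives `Y⁻¹ e_n = h_n`. In the same way the `expPos w` are the
  generating function of the Laguerre functions if `α = 0` and `δ = 1/2`.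
-/

open ArcToeplitz

/-! ### Uniqueness of two-sided Laplace transforms -/

/-- The real case. The finite measures with the densities `f⁺` and `f⁻` have moment generating
functions in `X` that agree near `0`, hence by analytic continuation on a strip around the imaginary
axis. So the images of these measures under `X` have the same characteristic function, and the
measurable left inverse `r` of `X` recovers the measures from their images. -/
theorem ae_eq_zero_of_integral_exp_mul_eq_zero_real {α : Type*} [MeasurableSpace α]
    {μ : Measure α} {X : α → ℝ} {r : ℝ → α} (hX : Measurable X) (hr : Measurable r)
    (hrX : ∀ᵐ x ∂μ, r (X x) = x) {f : α → ℝ} (hf : Measurable f) {ε : ℝ} (hε : 0 < ε)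
    (hint : ∀ t ∈ Ioo (-ε) ε, Integrable (fun x => Real.exp (t * X x) * f x) μ)
    (hzero : ∀ t ∈ Ioo (-ε) ε, ∫ x, Real.exp (t * X x) * f x ∂μ = 0) : f =ᵐ[μ] 0 := by
  have hf0 : Integrable f μ := by simpa using hint 0 ⟨by linarith, hε⟩
  let ρ : (α → ℝ) → Measure α := fun g => μ.withDensity fun x => ((g x).toNNReal : ℝ≥0∞)
  have hfin : ∀ g : α → ℝ, Integrable g μ → IsFiniteMeasure (ρ g) := fun g hg =>
    isFiniteMeasure_withDensity_ofReal hg.hasFiniteIntegral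
  have hsub : ∀ g : α → ℝ, Measurable g →
      (∀ t ∈ Ioo (-ε) ε, Integrable (fun x => Real.exp (t * X x) * g x) μ) →
      Ioo (-ε) ε ⊆ ProbabilityTheory.integrableExpSet X (ρ g) := by
    intro g hg hgi t ht
    change Integrable _ (ρ g)
    rw [integrable_withDensity_iff_integrable_smul hg.real_toNNReal]
    refine (hgi t ht).mono (by fun_prop) (.of_forall fun x => ?_)
    simp only [NNReal.smul_def, smul_eq_mul, norm_mul, Real.norm_eq_abs, Real.coe_toNNReal']
    rw [mul_comm]
    refine mul_le_mul_of_nonneg_left ?_ (abs_nonneg _)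
    rw [abs_of_nonneg (le_max_right (g x) 0)]
    exact max_le (le_abs_self _) (abs_nonneg _)
  have hint' : ∀ t ∈ Ioo (-ε) ε, Integrable (fun x => Real.exp (t * X x) * (-f x)) μ := by
    intro t ht
    simpa using (hint t ht).neg
  have hsub₁ := hsub f hf hint
  have hsub₂ := hsub (fun x => -f x) hf.neg hint'
  have hfm : Measurable fun x => -f x := hf.neg
  have := hfin f hf0
  have := hfin (fun x => -f x) hf0.neg
  have hreal : ∀ t ∈ Ioo (-ε) ε, ProbabilityTheory.complexMGF X (ρ f) t =
      ProbabilityTheory.complexMGF X (ρ fun x => -f x) t := by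
    intro t ht
    rw [ProbabilityTheory.complexMGF_ofReal, ProbabilityTheory.complexMGF_ofReal]
    congr 1
    have h₁ := hsub₁ ht
    have h₂ := hsub₂ ht
    change Integrable _ (ρ _) at h₁ h₂
    rw [integrable_withDensity_iff_integrable_smul hf.real_toNNReal] at h₁
    rw [integrable_withDensity_iff_integrable_smul hfm.real_toNNReal] at h₂
    rw [ProbabilityTheory.mgf, ProbabilityTheory.mgf,
      integral_withDensity_eq_integral_smul hf.real_toNNReal,
      integral_withDensity_eq_integral_smul hfm.real_toNNReal, ← sub_eq_zero,
      ← integral_sub h₁ h₂, ← hzero t ht]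
    refine integral_congr_ae (.of_forall fun x => ?_)
    simp only [NNReal.smul_def, smul_eq_mul, Real.coe_toNNReal', ← sub_mul]
    rw [mul_comm]
    congr 1
    exact max_zero_sub_max_neg_zero_eq_self (f x)
  let U : Set ℂ := {z | z.re ∈ Ioo (-ε) ε}
  have hU : IsPreconnected U :=
    ((convex_Ioo (-ε) ε).linear_preimage reLm).isPreconnected
  have hint_sub : ∀ g : α → ℝ, Ioo (-ε) ε ⊆ ProbabilityTheory.integrableExpSet X (ρ g) →
      AnalyticOnNhd ℂ (ProbabilityTheory.complexMGF X (ρ g)) U := fun g hg =>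
    ProbabilityTheory.analyticOnNhd_complexMGF.mono fun z hz =>
      interior_maximal hg isOpen_Ioo hz
  have heq : EqOn (ProbabilityTheory.complexMGF X (ρ f))
      (ProbabilityTheory.complexMGF X (ρ fun x => -f x)) U := by
    refine (hint_sub _ hsub₁).eqOn_of_preconnected_of_frequently_eq (hint_sub _ hsub₂) hU
      (z₀ := 0) (by simpa [U] using hε) ?_
    have hten : Tendsto (fun t : ℝ => (t : ℂ)) (𝓝[≠] 0) (𝓝[≠] 0) :=
      tendsto_nhdsWithin_of_tendsto_nhds_of_eventually_within _
        ((Complex.continuous_ofReal.tendsto' 0 0 (by simp)).mono_left nhdsWithin_le_nhds)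
        (by filter_upwards [self_mem_nhdsWithin] with t ht; simpa using ht)
    refine hten.frequently (Eventually.frequently ?_)
    filter_upwards [nhdsWithin_le_nhds (Ioo_mem_nhds (neg_lt_zero.2 hε) hε)] with t ht
    exact hreal t ht
  have hmap : (ρ f).map X = (ρ fun x => -f x).map X := by
    refine Measure.ext_of_charFun (funext fun t => ?_)
    rw [← ProbabilityTheory.complexMGF_mul_I hX.aemeasurable,
      ← ProbabilityTheory.complexMGF_mul_I hX.aemeasurable]
    exact heq (by simpa [U] using hε)
  have hback : ∀ g : α → ℝ, ((ρ g).map X).map r = ρ g := by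
    intro g
    rw [Measure.map_map hr hX]
    have : r ∘ X =ᵐ[ρ g] id := (withDensity_absolutelyContinuous _ _).ae_le hrX
    rw [Measure.map_congr this, Measure.map_id]
  have hρ : ρ f = ρ fun x => -f x := by rw [← hback f, hmap, hback]
  have hdens := (withDensity_eq_iff hf.ennreal_ofReal.aemeasurable
    hfm.ennreal_ofReal.aemeasurable (hf0.lintegral_lt_top.ne)).1 hρ
  filter_upwards [hdens] with x hx
  change ENNReal.ofReal (f x) = ENNReal.ofReal (-f x) at hx
  rcases lt_trichotomy (f x) 0 with h | h | h
  · rw [ENNReal.ofReal_of_nonpos h.le, eq_comm, ENNReal.ofReal_eq_zero] at hx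
    linarith
  · exact h
  · rw [ENNReal.ofReal_of_nonpos (neg_nonpos.2 h.le), ENNReal.ofReal_eq_zero] at hx
    linarith

/-- A function whose two-sided Laplace transform with respect to the variable `X` vanishes near `0`
is zero almost everywhere. -/
theorem ae_eq_zero_of_integral_exp_mul_eq_zero {α : Type*} [MeasurableSpace α]
    {μ : Measure α} {X : α → ℝ} {r : ℝ → α} (hX : Measurable X) (hr : Measurable r)
    (hrX : ∀ᵐ x ∂μ, r (X x) = x) {f : α → ℂ} (hf : Measurable f) {ε : ℝ} (hε : 0 < ε)
    (hint : ∀ t ∈ Ioo (-ε) ε, Integrable (fun x => (Real.exp (t * X x) : ℂ) * f x) μ)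
    (hzero : ∀ t ∈ Ioo (-ε) ε, ∫ x, (Real.exp (t * X x) : ℂ) * f x ∂μ = 0) : f =ᵐ[μ] 0 := by
  have h₁ := ae_eq_zero_of_integral_exp_mul_eq_zero_real hX hr hrX (f := fun x => (f x).re)
    (by fun_prop) hε
    (fun t ht => (hint t ht).re.congr (.of_forall fun x => Complex.re_ofReal_mul _ _))
    (fun t ht => by
      have := reCLM.integral_comp_comm (hint t ht)
      simpa only [hzero t ht, reCLM_apply, Complex.re_ofReal_mul, zero_re] using this)
  have h₂ := ae_eq_zero_of_integral_exp_mul_eq_zero_real hX hr hrX (f := fun x => (f x).im)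
    (by fun_prop) hε
    (fun t ht => (hint t ht).im.congr (.of_forall fun x => Complex.im_ofReal_mul _ _))
    (fun t ht => by
      have := imCLM.integral_comp_comm (hint t ht)
      simpa only [hzero t ht, imCLM_apply, Complex.im_ofReal_mul, zero_im] using this)
  filter_upwards [h₁, h₂] with x hx₁ hx₂
  exact Complex.ext hx₁ hx₂

/-! ### Hilbert space generalities -/

theorem denseRange_linearCombination {ι H : Type*} [NormedAddCommGroup H]
    [InnerProductSpace ℂ H] {u : ι → H}
    (hu : (Submodule.span ℂ (range u)).topologicalClosure = ⊤) :
    DenseRange (Finsupp.linearCombination ℂ u) := by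
  have := Submodule.dense_iff_topologicalClosure_eq_top.2 hu
  rwa [← Finsupp.range_linearCombination, LinearMap.coe_range] at this

/-- Two families with dense spans and the same Gram matrix are related by a unitary map. -/
theorem exists_linearIsometryEquiv_of_inner_eq {ι H₁ H₂ : Type*} [NormedAddCommGroup H₁]
    [InnerProductSpace ℂ H₁] [CompleteSpace H₁] [NormedAddCommGroup H₂] [InnerProductSpace ℂ H₂]
    [CompleteSpace H₂] {u : ι → H₁} {v : ι → H₂}
    (hu : (Submodule.span ℂ (range u)).topologicalClosure = ⊤)
    (hv : (Submodule.span ℂ (range v)).topologicalClosure = ⊤)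
    (huv : ∀ i j, inner ℂ (u i) (u j) = inner ℂ (v i) (v j)) :
    ∃ V : H₁ ≃ₗᵢ[ℂ] H₂, ∀ i, V (u i) = v i := by
  have hnorm : ∀ c : ι →₀ ℂ, ‖Finsupp.linearCombination ℂ v c‖ =
      ‖Finsupp.linearCombination ℂ u c‖ := by
    intro c
    have : inner ℂ (Finsupp.linearCombination ℂ v c) (Finsupp.linearCombination ℂ v c) =
        inner ℂ (Finsupp.linearCombination ℂ u c) (Finsupp.linearCombination ℂ u c) := by
      simp only [Finsupp.linearCombination_apply, Finsupp.sum_inner, Finsupp.inner_sum,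
        inner_smul_left, inner_smul_right, huv]
    rw [inner_self_eq_norm_sq_to_K, inner_self_eq_norm_sq_to_K] at this
    exact (pow_left_inj₀ (norm_nonneg _) (norm_nonneg _) two_ne_zero).1 (by exact_mod_cast this)
  refine ⟨(LinearEquiv.refl ℂ (ι →₀ ℂ)).extendOfIsometry (Finsupp.linearCombination ℂ u)
    (Finsupp.linearCombination ℂ v) (denseRange_linearCombination hu)
    (denseRange_linearCombination hv) hnorm, fun i => ?_⟩
  have := (LinearEquiv.refl ℂ (ι →₀ ℂ)).extendOfIsometry_eq (Finsupp.linearCombination ℂ u)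
    (Finsupp.linearCombination ℂ v) (denseRange_linearCombination hu)
    (denseRange_linearCombination hv) hnorm (Finsupp.single i 1)
  simpa using this

theorem coeFn_mulOp {E : Type*} [MeasurableSpace E] {μ : Measure E} (ω : Lp ℂ ∞ μ)
    (f : Lp ℂ 2 μ) : mulOp ω f =ᵐ[μ] fun x => ω x * f x :=
  (ContinuousLinearMap.mul ℂ ℂ).coeFn_holder ω f

theorem topologicalClosure_span_eq_top_of_inner_eq_zero {ι H : Type*} [NormedAddCommGroup H]
    [InnerProductSpace ℂ H] [CompleteSpace H] {u : ι → H}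
    (h : ∀ f : H, (∀ i, inner ℂ (u i) f = 0) → f = 0) :
    (Submodule.span ℂ (range u)).topologicalClosure = ⊤ := by
  rw [Submodule.topologicalClosure_eq_top_iff, Submodule.eq_bot_iff]
  intro f hf
  refine h f fun i => ?_
  exact (Submodule.mem_orthogonal _ _).1 hf _ (Submodule.subset_span ⟨i, rfl⟩)

/-! ### Taylor coefficients of a power series in `L²` -/

theorem taylorCoeff_of_hasFPowerSeriesAt {f : ℂ → ℂ} {p : FormalMultilinearSeries ℂ ℂ ℂ}
    (h : HasFPowerSeriesAt f p 0) (n : ℕ) : taylorCoeff f n = p.coeff n := by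
  obtain ⟨r, hr⟩ := h
  have := hr.factorial_smul (1 : ℂ) n
  rw [taylorCoeff, iteratedDeriv_eq_iteratedFDeriv,
    div_eq_iff (by exact_mod_cast n.factorial_ne_zero), mul_comm, FormalMultilinearSeries.coeff]
  simpa using this.symm

/-- A function that is analytic at `0` and equals a power series at the points of a sequence
converging to `0` has the coefficients of the series as Taylor coefficients. -/
theorem taylorCoeff_of_hasSum {a : ℕ → ℂ} {F : ℂ → ℂ} {q : ℕ → ℂ} (hq : Tendsto q atTop (𝓝[≠] 0))
    (hF : AnalyticAt ℂ F 0) (h : ∀ᶠ k in atTop, HasSum (fun n => q k ^ n * a n) (F (q k)))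
    (n : ℕ) : taylorCoeff F n = a n := by
  set p : FormalMultilinearSeries ℂ ℂ ℂ := FormalMultilinearSeries.ofScalars ℂ a with hp
  -- convergence at a single point `q k ≠ 0` already gives a positive radius of convergence
  have hrad : 0 < p.radius := by
    obtain ⟨k, hk, hne⟩ := (h.and (hq.eventually self_mem_nhdsWithin)).exists
    obtain ⟨C, hC⟩ := hk.summable.tendsto_atTop_zero.norm.bddAbove_range
    refine lt_of_lt_of_le ?_ (p.le_radius_of_bound (r := ‖q k‖₊) C fun n => ?_)
    · simpa using hne
    · rw [hp, FormalMultilinearSeries.ofScalars_norm]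
      have := hC ⟨n, rfl⟩
      simpa [mul_comm] using this
  have hps : HasFPowerSeriesAt p.sum p 0 := (p.hasFPowerSeriesOnBall hrad).hasFPowerSeriesAt
  have hfreq : ∃ᶠ z in 𝓝[≠] (0 : ℂ), F z = p.sum z := by
    refine hq.frequently (Eventually.frequently ?_)
    filter_upwards [h] with k hk
    rw [← hk.tsum_eq, FormalMultilinearSeries.sum]
    refine tsum_congr fun n => ?_
    simp [hp, FormalMultilinearSeries.ofScalars, mul_comm]
  have hev := (hF.frequently_eq_iff_eventually_eq hps.analyticAt).1 hfreq
  have hFs : HasFPowerSeriesAt F p 0 := hps.congr (hev.mono fun z hz => hz.symm)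
  rw [taylorCoeff_of_hasFPowerSeriesAt hFs n]
  simp [hp]

/-- If power series in `q` with coefficients `g n` of norm `1` in `L²` converges in `L²` for a sequence
of parameters `q k → 0` to functions `s ↦ F s (q k)` with `F s` analytic at `0`, then the `g n` are
the pointwise Taylor coefficients of `F`. -/
theorem ae_eq_taylorCoeff {α : Type*} [MeasurableSpace α] {μ : Measure α} {g : ℕ → Lp ℂ 2 μ}
    (hg : ∀ n, ‖g n‖ = 1) {F : α → ℂ → ℂ} {q : ℕ → ℂ} (hq : Tendsto q atTop (𝓝[≠] 0))
    {G : ℕ → Lp ℂ 2 μ} (hG : ∀ᶠ k in atTop, HasSum (fun n => q k ^ n • g n) (G k))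
    (hF : ∀ᶠ k in atTop, G k =ᵐ[μ] fun s => F s (q k)) (han : ∀ᵐ s ∂μ, AnalyticAt ℂ (F s) 0)
    (n : ℕ) : g n =ᵐ[μ] fun s => taylorCoeff (F s) n := by
  have hsmall : ∀ᶠ k in atTop, ‖q k‖ < 1 := by
    have := (hq.mono_right nhdsWithin_le_nhds).norm
    rw [norm_zero] at this
    exact this.eventually (gt_mem_nhds one_pos)
  obtain ⟨N, hN⟩ := eventually_atTop.1 ((hsmall.and hG).and hF)
  have hpt : ∀ᵐ s ∂μ, ∀ k, N ≤ k → HasSum (fun n => q k ^ n * g n s) (F s (q k)) := by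
    rw [ae_all_iff]
    intro k
    by_cases hk : N ≤ k
    swap
    · simp [hk]
    obtain ⟨⟨hs, hGk⟩, hFk⟩ := hN k hk
    have hco : ∀ᵐ s ∂μ, ∀ i, (q k ^ i • g i : Lp ℂ 2 μ) s = q k ^ i * g i s := by
      rw [ae_all_iff]
      intro i
      filter_upwards [Lp.coeFn_smul (q k ^ i) (g i)] with s hs
      simpa using hs
    -- absolute convergence in norm gives convergence almost everywhere
    have hsum : ∑' n, ‖q k ^ n • g n‖ₑ ≠ ∞ := by
      refine (Summable.tsum_ofReal_ne_top (f := fun n => ‖q k‖ ^ n)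
        (summable_geometric_of_lt_one (norm_nonneg _) hs)) |> fun h => ?_
      simpa only [← ofReal_norm, norm_smul, norm_pow, hg, mul_one] using h
    filter_upwards [Lp.hasSum_coeFn_tsum hsum, hco, hFk] with s h1 h2 h3 _
    simpa only [hGk.tsum_eq, h2, h3] using h1
  filter_upwards [hpt, han] with s hs hans
  exact (taylorCoeff_of_hasSum hq hans (eventually_atTop.2 ⟨N, hs⟩) n).symm

/-! ### The exponentials in `L²(ℝ₊)` -/

theorem inner_toLp_ofReal {α : Type*} [MeasurableSpace α] {μ : Measure α} {k : α → ℝ}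
    (hk : MemLp (fun x => (k x : ℂ)) 2 μ) (f : Lp ℂ 2 μ) :
    inner ℂ (hk.toLp _) f = ∫ x, (k x : ℂ) * f x ∂μ := by
  rw [L2.inner_def]
  refine integral_congr_ae ?_
  filter_upwards [hk.coeFn_toLp] with x hx
  rw [hx, RCLike.inner_apply, conj_ofReal, mul_comm]

theorem inner_toLp_ofReal_toLp {α : Type*} [MeasurableSpace α] {μ : Measure α} {k : α → ℝ}
    (hk : MemLp (fun x => (k x : ℂ)) 2 μ) {f : α → ℂ} (hf : MemLp f 2 μ) :
    inner ℂ (hk.toLp _) (hf.toLp f) = ∫ x, (k x : ℂ) * f x ∂μ := by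
  rw [inner_toLp_ofReal]
  refine integral_congr_ae ?_
  filter_upwards [hf.coeFn_toLp] with x hx
  rw [hx]

theorem integrable_ofReal_mul {α : Type*} [MeasurableSpace α] {μ : Measure α} {k : α → ℝ}
    (hk : MemLp (fun x => (k x : ℂ)) 2 μ) (f : Lp ℂ 2 μ) :
    Integrable (fun x => (k x : ℂ) * f x) μ :=
  hk.integrable_mul (Lp.memLp f)

theorem memLp_exp_neg {w : ℝ} (hw : 0 < w) :
    MemLp (fun x : ℝ => (Real.exp (-w * x) : ℂ)) 2 (volume.restrict (Ioi (0 : ℝ))) := by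
  rw [memLp_two_iff_integrable_sq_norm (by fun_prop)]
  refine (integrableOn_exp_mul_Ioi (a := -(2 * w)) (by linarith) 0).congr_fun
    (fun x _ => ?_) measurableSet_Ioi
  simp only
  rw [Complex.norm_real, Real.norm_eq_abs, abs_of_pos (Real.exp_pos _), sq, ← Real.exp_add]
  ring_nf

/-- The function `x ↦ exp (-wx)` as an element of `L²(ℝ₊)`, for `w > 0`. -/
noncomputable def expPos (w : Ioi (0 : ℝ)) : L2Pos := (memLp_exp_neg w.2).toLp _

theorem inner_expPos (w : Ioi (0 : ℝ)) (f : L2Pos) :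
    inner ℂ (expPos w) f = ∫ x in Ioi (0 : ℝ), (Real.exp (-w * x) : ℂ) * f x :=
  inner_toLp_ofReal _ f

theorem inner_expPos_expPos (w v : Ioi (0 : ℝ)) :
    inner ℂ (expPos w) (expPos v) = ((1 / (w + v) : ℝ) : ℂ) := by
  have hw : (0 : ℝ) < w := w.2
  have hv : (0 : ℝ) < v := v.2
  rw [expPos, expPos, inner_toLp_ofReal_toLp]
  simp_rw [← ofReal_mul, ← Real.exp_add, ← add_mul]
  rw [integral_complex_ofReal, integral_exp_mul_Ioi (by linarith)]
  rw [mul_zero, Real.exp_zero, ← neg_add, neg_div_neg_eq]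

/-- The inner products with the exponentials are the values of the Laplace transform of `f`; the
factor `exp (-x)` moves the point `w = 1` to the origin. -/
theorem eq_zero_of_inner_expPos {f : L2Pos} (hf : ∀ w, inner ℂ (expPos w) f = 0) : f = 0 := by
  rw [Lp.eq_zero_iff_ae_eq_zero]
  have hmul : ∀ t x : ℝ, (Real.exp (t * -x) : ℂ) * ((Real.exp (-1 * x) : ℂ) * f x) =
      (Real.exp (-(1 + t) * x) : ℂ) * f x := by
    intro t x
    rw [← mul_assoc, ← ofReal_mul, ← Real.exp_add]
    ring_nf
  have h := ae_eq_zero_of_integral_exp_mul_eq_zero (μ := volume.restrict (Ioi (0 : ℝ)))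
    (X := fun x => -x) (r := fun x => -x) measurable_neg measurable_neg
    (.of_forall fun x => neg_neg x) (f := fun x => (Real.exp (-1 * x) : ℂ) * f x)
    (by have := (Lp.stronglyMeasurable f).measurable; fun_prop) one_pos
    (fun t ht => by
      simp only [hmul]
      exact integrable_ofReal_mul (memLp_exp_neg (by linarith [ht.1])) f)
    (fun t ht => by
      simp only [hmul]
      exact (inner_expPos ⟨1 + t, by simpa using by linarith [ht.1]⟩ f).symm.trans (hf _))
  filter_upwards [h] with x hx
  simpa using hx

theorem topologicalClosure_span_expPos :
    (Submodule.span ℂ (range expPos)).topologicalClosure = ⊤ :=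
  topologicalClosure_span_eq_top_of_inner_eq_zero fun _ => eq_zero_of_inner_expPos

/-! ### Beta integrals -/

theorem integrableOn_rpow_mul_one_sub_rpow {u v : ℝ} (hu : 0 < u) (hv : 0 < v) :
    IntegrableOn (fun s : ℝ => s ^ (u - 1) * (1 - s) ^ (v - 1)) (Ioo 0 1) := by
  have h := (intervalIntegrable_iff_integrableOn_Ioo_of_le zero_le_one).1
    (betaIntegral_convergent (u := u) (v := v) (by simpa) (by simpa))
  refine IntegrableOn.congr_fun h.re (fun s hs => ?_) measurableSet_Ioo
  rw [show (s : ℂ) ^ (u - 1 : ℂ) * (1 - s : ℂ) ^ (v - 1 : ℂ) =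
    ((s ^ (u - 1) * (1 - s) ^ (v - 1) : ℝ) : ℂ) by
      push_cast [ofReal_cpow hs.1.le, ofReal_cpow (sub_nonneg.2 hs.2.le)]; rfl]
  exact ofReal_re _

theorem integral_rpow_mul_one_sub_rpow {u v : ℝ} (hu : 0 < u) (hv : 0 < v) :
    ∫ s in Ioo (0 : ℝ) 1, s ^ (u - 1) * (1 - s) ^ (v - 1) =
      Real.Gamma u * Real.Gamma v / Real.Gamma (u + v) := by
  have h : ((∫ s in Ioo (0 : ℝ) 1, s ^ (u - 1) * (1 - s) ^ (v - 1) : ℝ) : ℂ) =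
      betaIntegral u v := by
    rw [betaIntegral, intervalIntegral.integral_of_le zero_le_one, integral_Ioc_eq_integral_Ioo,
      ← integral_complex_ofReal]
    refine setIntegral_congr_fun measurableSet_Ioo fun s hs => ?_
    push_cast [ofReal_cpow hs.1.le, ofReal_cpow (sub_nonneg.2 hs.2.le)]; rfl
  have h2 := Gamma_mul_Gamma_eq_betaIntegral (s := u) (t := v) (by simpa) (by simpa)
  rw [← h, ← ofReal_add, Gamma_ofReal, Gamma_ofReal, Gamma_ofReal] at h2
  rw [eq_div_iff (Real.Gamma_pos_of_pos (by linarith)).ne', mul_comm]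
  exact_mod_cast h2.symm

theorem integral_rpow_neg_mul_one_sub_rpow {c : ℝ} (h0 : 0 < c) (h1 : c < 1) :
    ∫ s in Ioo (0 : ℝ) 1, s ^ (-c) * (1 - s) ^ (c - 1) = π / Real.sin (π * c) := by
  have h := integral_rpow_mul_one_sub_rpow (u := 1 - c) (v := c) (by linarith) h0
  rw [sub_add_cancel, Real.Gamma_one, div_one, mul_comm, Real.Gamma_mul_Gamma_one_sub] at h
  rw [← h]
  ring_nf

theorem integral_rpow_one_sub_mul_one_sub_rpow {c : ℝ} (h0 : 0 < c) (h1 : c < 1) :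
    ∫ s in Ioo (0 : ℝ) 1, s ^ (1 - c) * (1 - s) ^ (c - 1) = (1 - c) * (π / Real.sin (π * c)) := by
  have h := integral_rpow_mul_one_sub_rpow (u := (1 - c) + 1) (v := c) (by linarith) h0
  rw [Real.Gamma_add_one (by linarith), show 1 - c + 1 + c = 2 by ring, Real.Gamma_two, div_one,
    mul_assoc, mul_comm (Real.Gamma (1 - c)), Real.Gamma_mul_Gamma_one_sub] at h
  rw [← h]
  ring_nf

/-! ### The functions in `L²(0,1)` corresponding to the exponentials -/

/-- The inverse image under `V` of `x ↦ exp (-wx)`. With `a = arctan w / π` it is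
`s ↦ π^(-1/2) (1 + w²)^(-1/2) s^(-a) (1 - s)^(a - 1/2)`. -/
noncomputable def kerUnit (w s : ℝ) : ℝ :=
  (√π)⁻¹ * (√(1 + w ^ 2))⁻¹ *
    (s ^ (-(Real.arctan w / π)) * (1 - s) ^ (Real.arctan w / π - 1 / 2))

theorem arctan_div_pi_pos {w : ℝ} (hw : 0 < w) : 0 < Real.arctan w / π :=
  div_pos (Real.arctan_pos.2 hw) Real.pi_pos

theorem arctan_div_pi_lt (w : ℝ) : Real.arctan w / π < 1 / 2 := by
  rw [div_lt_iff₀ Real.pi_pos]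
  linarith [Real.arctan_lt_pi_div_two w]

theorem memLp_rpow_neg_mul_one_sub_rpow {a : ℝ} (h0 : 0 < a) (h1 : a < 1 / 2) :
    MemLp (fun s : ℝ => ((s ^ (-a) * (1 - s) ^ (a - 1 / 2) : ℝ) : ℂ)) 2
      (volume.restrict (Ioo (0 : ℝ) 1)) := by
  rw [memLp_two_iff_integrable_sq_norm (Measurable.aestronglyMeasurable (by fun_prop))]
  refine IntegrableOn.congr_fun (integrableOn_rpow_mul_one_sub_rpow (u := 1 - 2 * a) (v := 2 * a)
    (by linarith) (by linarith)) (fun s hs => ?_) measurableSet_Ioo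
  have h2 : 0 < 1 - s := sub_pos.2 hs.2
  have h3 := Real.rpow_pos_of_pos hs.1 (-a)
  have h4 := Real.rpow_pos_of_pos h2 (a - 1 / 2)
  rw [Complex.norm_real, Real.norm_eq_abs, abs_of_pos (mul_pos h3 h4), mul_pow,
    ← Real.rpow_natCast, ← Real.rpow_natCast, ← Real.rpow_mul hs.1.le, ← Real.rpow_mul h2.le]
  congr 2 <;> push_cast <;> ring

theorem memLp_kerUnit {w : ℝ} (hw : 0 < w) :
    MemLp (fun s => (kerUnit w s : ℂ)) 2 (volume.restrict (Ioo (0 : ℝ) 1)) := by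
  have := (memLp_rpow_neg_mul_one_sub_rpow (arctan_div_pi_pos hw) (arctan_div_pi_lt w)).const_mul
    (((√π)⁻¹ * (√(1 + w ^ 2))⁻¹ : ℝ) : ℂ)
  simpa only [kerUnit, ofReal_mul] using this

/-- The function `kerUnit w` as an element of `L²(0,1)`, for `w > 0`. -/
noncomputable def kerLp (w : Ioi (0 : ℝ)) : L2Unit := (memLp_kerUnit w.2).toLp _

theorem kerUnit_mul_kerUnit (w v : ℝ) {s : ℝ} (hs : s ∈ Ioo (0 : ℝ) 1) :
    kerUnit w s * kerUnit v s = π⁻¹ * ((√(1 + w ^ 2))⁻¹ * (√(1 + v ^ 2))⁻¹) *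
      (s ^ (-(Real.arctan w / π + Real.arctan v / π)) *
        (1 - s) ^ (Real.arctan w / π + Real.arctan v / π - 1)) := by
  have h2 : 0 < 1 - s := sub_pos.2 hs.2
  have e1 : s ^ (-(Real.arctan w / π + Real.arctan v / π)) =
      s ^ (-(Real.arctan w / π)) * s ^ (-(Real.arctan v / π)) := by
    rw [← Real.rpow_add hs.1]; ring_nf
  have e2 : (1 - s) ^ (Real.arctan w / π + Real.arctan v / π - 1) =
      (1 - s) ^ (Real.arctan w / π - 1 / 2) * (1 - s) ^ (Real.arctan v / π - 1 / 2) := by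
    rw [← Real.rpow_add h2]; ring_nf
  have e3 : π⁻¹ = (√π)⁻¹ * (√π)⁻¹ := by
    rw [← mul_inv, Real.mul_self_sqrt Real.pi_pos.le]
  rw [e1, e2, e3, kerUnit, kerUnit]
  ring

theorem arctan_add_arctan_div_pi_mem (w v : Ioi (0 : ℝ)) :
    Real.arctan w / π + Real.arctan v / π ∈ Ioo (0 : ℝ) 1 :=
  ⟨add_pos (arctan_div_pi_pos w.2) (arctan_div_pi_pos v.2), by
    linarith [arctan_div_pi_lt w, arctan_div_pi_lt v]⟩

/-- This is the addition theorem for `sin (arctan w + arctan v)`. -/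
theorem gram_const_mul_sin (w v : Ioi (0 : ℝ)) :
    π⁻¹ * ((√(1 + (w : ℝ) ^ 2))⁻¹ * (√(1 + (v : ℝ) ^ 2))⁻¹) *
      (π / Real.sin (π * (Real.arctan w / π + Real.arctan v / π))) = 1 / (w + v) := by
  have hw : (0 : ℝ) < w := w.2
  have hv : (0 : ℝ) < v := v.2
  have hπ := Real.pi_pos
  have e : π * (Real.arctan w / π + Real.arctan v / π) = Real.arctan w + Real.arctan v := by
    field_simp
  rw [e, Real.sin_add, Real.sin_arctan, Real.sin_arctan, Real.cos_arctan, Real.cos_arctan]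
  field_simp

theorem inner_kerLp_kerLp (w v : Ioi (0 : ℝ)) :
    inner ℂ (kerLp w) (kerLp v) = ((1 / (w + v) : ℝ) : ℂ) := by
  rw [kerLp, kerLp, inner_toLp_ofReal_toLp]
  simp_rw [← ofReal_mul]
  rw [integral_complex_ofReal, setIntegral_congr_fun measurableSet_Ioo
    fun s hs => kerUnit_mul_kerUnit w v hs, integral_const_mul,
    integral_rpow_neg_mul_one_sub_rpow (arctan_add_arctan_div_pi_mem w v).1
      (arctan_add_arctan_div_pi_mem w v).2, gram_const_mul_sin]

theorem inner_kerLp_mulOp_idUnit (w v : Ioi (0 : ℝ)) :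
    inner ℂ (kerLp w) (mulOp idUnit (kerLp v)) =
      (((1 - (Real.arctan w / π + Real.arctan v / π)) / (w + v) : ℝ) : ℂ) := by
  rw [kerLp, inner_toLp_ofReal]
  have hc := arctan_add_arctan_div_pi_mem w v
  set c := Real.arctan w / π + Real.arctan v / π with hcdef
  have h1 : ∀ᵐ s ∂(volume.restrict (Ioo (0 : ℝ) 1)),
      (kerUnit w s : ℂ) * (mulOp idUnit (kerLp v) : L2Unit) s =
      ((π⁻¹ * ((√(1 + (w : ℝ) ^ 2))⁻¹ * (√(1 + (v : ℝ) ^ 2))⁻¹) *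
        (s ^ (1 - c) * (1 - s) ^ (c - 1)) : ℝ) : ℂ) := by
    filter_upwards [coeFn_mulOp idUnit (kerLp v), memLp_id_unit.coeFn_toLp,
      (memLp_kerUnit v.2).coeFn_toLp, ae_restrict_mem measurableSet_Ioo] with s h1 h2 h3 hs
    rw [h1, idUnit, h2, kerLp, h3, ← ofReal_mul, ← ofReal_mul, mul_left_comm,
      kerUnit_mul_kerUnit w v hs, sub_eq_add_neg 1 c, Real.rpow_add hs.1, Real.rpow_one]
    congr 1
    ring
  rw [integral_congr_ae h1, integral_complex_ofReal, integral_const_mul,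
    integral_rpow_one_sub_mul_one_sub_rpow hc.1 hc.2, mul_left_comm, gram_const_mul_sin]
  congr 1
  ring

/-- In the variable `log (1/s - 1)` the functions `kerUnit w` are, up to constants, exponentials times
a fixed weight, so that the inner products with them are values of a two-sided Laplace transform. -/
theorem eq_zero_of_inner_kerLp {f : L2Unit} (hf : ∀ w, inner ℂ (kerLp w) f = 0) : f = 0 := by
  rw [Lp.eq_zero_iff_ae_eq_zero]
  have hae : ∀ t : ℝ, (fun s => (Real.exp (t * Real.log (1 / s - 1)) : ℂ) *
      (((s ^ (-(1 / 4) : ℝ) * (1 - s) ^ (-(1 / 4) : ℝ) : ℝ) : ℂ) * f s))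
      =ᵐ[volume.restrict (Ioo (0 : ℝ) 1)]
      fun s => ((s ^ (-(1 / 4 + t)) * (1 - s) ^ (1 / 4 + t - 1 / 2) : ℝ) : ℂ) * f s := by
    intro t
    filter_upwards [ae_restrict_mem measurableSet_Ioo] with s hs
    have h2 : 0 < 1 - s := sub_pos.2 hs.2
    have h3 : (1 : ℝ) / s - 1 = (1 - s) / s := by field_simp [hs.1.ne']
    rw [← mul_assoc, ← ofReal_mul, h3, Real.log_div h2.ne' hs.1.ne', Real.rpow_def_of_pos hs.1,
      Real.rpow_def_of_pos h2, Real.rpow_def_of_pos hs.1, Real.rpow_def_of_pos h2,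
      ← Real.exp_add, ← Real.exp_add, ← Real.exp_add]
    ring_nf
  have hr : ∀ᵐ s ∂(volume.restrict (Ioo (0 : ℝ) 1)),
      1 / (1 + Real.exp (Real.log (1 / s - 1))) = s := by
    filter_upwards [ae_restrict_mem measurableSet_Ioo] with s hs
    have h3 : 0 < 1 / s - 1 := by rw [sub_pos, lt_div_iff₀ hs.1]; linarith [hs.2]
    rw [Real.exp_log h3]
    simp
  have h := ae_eq_zero_of_integral_exp_mul_eq_zero (μ := volume.restrict (Ioo (0 : ℝ) 1))
    (X := fun s => Real.log (1 / s - 1)) (r := fun y => 1 / (1 + Real.exp y)) (by fun_prop)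
    (by fun_prop) hr
    (f := fun s => ((s ^ (-(1 / 4) : ℝ) * (1 - s) ^ (-(1 / 4) : ℝ) : ℝ) : ℂ) * f s)
    (by have := (Lp.stronglyMeasurable f).measurable; fun_prop) (ε := 1 / 4) (by norm_num)
    (fun t ht => (integrable_congr (hae t)).2 (integrable_ofReal_mul
      (memLp_rpow_neg_mul_one_sub_rpow (by linarith [ht.1]) (by linarith [ht.2])) f))
    (fun t ht => by
      rw [integral_congr_ae (hae t)]
      have hπ := Real.pi_pos
      have ha : 0 < π * (1 / 4 + t) := mul_pos hπ (by linarith [ht.1])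
      have hb : π * (1 / 4 + t) < π / 2 := by nlinarith [ht.2]
      -- the exponent `1/4 + t` belongs to the parameter `w = tan (π (1/4 + t))`
      have hw : 0 < Real.tan (π * (1 / 4 + t)) := Real.tan_pos_of_pos_of_lt_pi_div_two ha hb
      have h0 := hf ⟨_, hw⟩
      rw [kerLp, inner_toLp_ofReal] at h0
      simp only [kerUnit, ofReal_mul _ (_ * _), mul_assoc (ofReal _)] at h0
      rw [integral_const_mul, Real.arctan_tan (by linarith) hb, mul_div_cancel_left₀ _ hπ.ne',
        mul_eq_zero, ofReal_eq_zero] at h0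
      exact h0.resolve_left (by positivity))
  filter_upwards [h, ae_restrict_mem measurableSet_Ioo] with s hs hs'
  have h2 : 0 < 1 - s := sub_pos.2 hs'.2
  have h3 := Real.rpow_pos_of_pos hs'.1 (-(1 / 4))
  have h4 := Real.rpow_pos_of_pos h2 (-(1 / 4))
  exact (mul_eq_zero.1 hs).resolve_left (by exact_mod_cast (mul_pos h3 h4).ne')

theorem topologicalClosure_span_kerLp :
    (Submodule.span ℂ (range kerLp)).topologicalClosure = ⊤ :=
  topologicalClosure_span_eq_top_of_inner_eq_zero fun _ => eq_zero_of_inner_kerLp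

/-! ### The Laplace transform of the kernel of `V` -/

theorem integrableOn_rpow_mul_exp_neg_mul {s b : ℝ} (hs : -1 < s) (hb : 0 < b) :
    IntegrableOn (fun t : ℝ => t ^ s * Real.exp (-b * t)) (Ioi 0) := by
  simpa only [Real.rpow_one] using integrableOn_rpow_mul_exp_neg_mul_rpow hs one_pos hb

theorem norm_cpow_mul_exp_neg_mul (a r : ℂ) {t : ℝ} (ht : 0 < t) :
    ‖(t : ℂ) ^ (a - 1) * cexp (-(r * t))‖ = t ^ (a.re - 1) * Real.exp (-r.re * t) := by
  rw [norm_mul, norm_cpow_eq_rpow_re_of_pos ht, Complex.norm_exp]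
  simp

theorem measurable_cpow_mul_exp_neg_mul (a r : ℂ) :
    Measurable fun t : ℝ => (t : ℂ) ^ (a - 1) * cexp (-(r * t)) := by
  fun_prop

theorem integrableOn_cpow_mul_exp_neg_mul {a r : ℂ} (ha : 0 < a.re) (hr : 0 < r.re) :
    IntegrableOn (fun t : ℝ => (t : ℂ) ^ (a - 1) * cexp (-(r * t))) (Ioi 0) := by
  refine (integrableOn_rpow_mul_exp_neg_mul (s := a.re - 1) (by linarith) hr).mono'
    (measurable_cpow_mul_exp_neg_mul a r).aestronglyMeasurable ?_
  filter_upwards [ae_restrict_mem measurableSet_Ioi] with t ht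
  exact (norm_cpow_mul_exp_neg_mul a r ht).le

theorem differentiableOn_integral_cpow_mul_exp_neg_mul {a : ℂ} (ha : 0 < a.re) :
    DifferentiableOn ℂ (fun r : ℂ => ∫ t : ℝ in Ioi 0, (t : ℂ) ^ (a - 1) * cexp (-(r * t)))
      {r | 0 < r.re} := by
  intro r₀ (hr₀ : 0 < r₀.re)
  refine HasDerivAt.differentiableAt (f' := ∫ t : ℝ in Ioi 0,
    (t : ℂ) ^ (a - 1) * (cexp (-(r₀ * t)) * -(t : ℂ))) ?_ |>.differentiableWithinAt
  refine (hasDerivAt_integral_of_dominated_loc_of_deriv_le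
    (F' := fun r t => (t : ℂ) ^ (a - 1) * (cexp (-(r * t)) * -(t : ℂ)))
    (bound := fun t => t ^ a.re * Real.exp (-(r₀.re / 2) * t))
    (s := {r : ℂ | r₀.re / 2 < r.re}) ?_ ?_ ?_ ?_ ?_ ?_ ?_).2
  · exact (isOpen_lt continuous_const Complex.continuous_re).mem_nhds
      (by change r₀.re / 2 < r₀.re; linarith)
  · exact .of_forall fun r => (measurable_cpow_mul_exp_neg_mul a r).aestronglyMeasurable
  · exact integrableOn_cpow_mul_exp_neg_mul ha hr₀
  · exact Measurable.aestronglyMeasurable (by fun_prop)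
  · filter_upwards [ae_restrict_mem measurableSet_Ioi] with t ht r hr
    rw [← mul_assoc, norm_mul, norm_cpow_mul_exp_neg_mul a r ht, norm_neg, Complex.norm_real,
      Real.norm_eq_abs, abs_of_pos ht]
    have h1 : t ^ a.re = t ^ (a.re - 1) * t := by
      rw [Real.rpow_sub_one (mem_Ioi.1 ht).ne', div_mul_cancel₀ _ (mem_Ioi.1 ht).ne']
    rw [h1, mul_right_comm]
    have h2 : -r.re * t ≤ -(r₀.re / 2) * t :=
      mul_le_mul_of_nonneg_right (neg_le_neg (le_of_lt hr)) (le_of_lt ht)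
    have h3 : 0 ≤ t ^ (a.re - 1) * t :=
      mul_nonneg (Real.rpow_nonneg (le_of_lt ht) _) (le_of_lt ht)
    exact mul_le_mul_of_nonneg_left (Real.exp_le_exp.2 h2) h3
  · exact integrableOn_rpow_mul_exp_neg_mul (by linarith) (by linarith)
  · refine .of_forall fun t r _ => ?_
    have h1 : HasDerivAt (fun r : ℂ => -(r * t)) (-(t : ℂ)) r := by
      have h2 : HasDerivAt (fun r : ℂ => r * t) (1 * (t : ℂ)) r := (hasDerivAt_id r).mul_const _
      rw [one_mul] at h2
      exact h2.fun_neg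
    exact h1.cexp.const_mul _

/-- The Gamma integral `∫ t^(a-1) exp (-rt) dt = r^(-a) Γ(a)` for complex `r` with `Re r > 0`, by
analytic continuation from real `r`. -/
theorem integral_cpow_mul_exp_neg_mul_Ioi_of_re_pos {a r : ℂ} (ha : 0 < a.re) (hr : 0 < r.re) :
    ∫ t : ℝ in Ioi 0, (t : ℂ) ^ (a - 1) * cexp (-(r * t)) = r ^ (-a) * Gamma a := by
  have hopen : IsOpen {r : ℂ | 0 < r.re} := isOpen_lt continuous_const Complex.continuous_re
  have hpre : IsPreconnected {r : ℂ | 0 < r.re} :=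
    (convex_halfSpace_re_gt 0).isPreconnected
  have h1 := (differentiableOn_integral_cpow_mul_exp_neg_mul ha).analyticOnNhd hopen
  have h2 : AnalyticOnNhd ℂ (fun r : ℂ => r ^ (-a) * Gamma a) {r | 0 < r.re} := fun r hr =>
    (analyticAt_id.cpow analyticAt_const (Or.inl hr)).mul analyticAt_const
  refine h1.eqOn_of_preconnected_of_frequently_eq h2 hpre (z₀ := 1) (by simp) ?_ hr
  have hten : Tendsto (fun t : ℝ => (t : ℂ)) (𝓝[≠] 1) (𝓝[≠] 1) :=
    tendsto_nhdsWithin_of_tendsto_nhds_of_eventually_within _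
      ((Complex.continuous_ofReal.tendsto' 1 1 (by simp)).mono_left nhdsWithin_le_nhds)
      (by filter_upwards [self_mem_nhdsWithin] with t ht; simpa using ht)
  refine hten.frequently (Eventually.frequently ?_)
  filter_upwards [nhdsWithin_le_nhds (lt_mem_nhds one_pos)] with t ht
  rw [integral_cpow_mul_exp_neg_mul_Ioi ha ht, one_div, inv_cpow _ _ (by
    rw [arg_ofReal_of_nonneg (le_of_lt ht)]; exact Real.pi_pos.ne), cpow_neg]

/-- The integral occurring in the kernel of `V`, with `l` in place of `(1/2π) ln (1/s - 1)`. -/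
noncomputable def kerInner (l x : ℝ) : ℂ :=
  ∫ u in (-1 : ℝ)..1, cexp (-(I * x * u)) * (((1 - u ^ 2) ^ (-(1 / 2 : ℝ)) : ℝ) : ℂ) *
      cexp (I * l * Real.log ((1 - u) / (1 + u)))

theorem kernelQ_eq (s x : ℝ) : kernelQ s x =
    ((1 / 2 * π ^ (-(3 / 2 : ℝ)) * s⁻¹ * (1 - s) ^ (-(1 / 2 : ℝ)) : ℝ) : ℂ) *
      kerInner (Real.log (1 / s - 1) / (2 * π)) x := by
  rw [kernelQ, kerInner]
  congr 2
  funext u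
  congr 2
  push_cast
  ring

theorem one_sub_cpow_mul_one_add_cpow (l : ℝ) {u : ℝ} (hu : u ∈ Ioo (-1 : ℝ) 1) :
    ((1 - u : ℝ) : ℂ) ^ (-(1 / 2) + I * l) * ((1 + u : ℝ) : ℂ) ^ (-(1 / 2) - I * l) =
    (((1 - u ^ 2) ^ (-(1 / 2 : ℝ)) : ℝ) : ℂ) * cexp (I * l * Real.log ((1 - u) / (1 + u))) := by
  have h1 : 0 < 1 - u := by linarith [hu.2]
  have h2 : 0 < 1 + u := by linarith [hu.1]
  have h3 : 1 - u ^ 2 = (1 - u) * (1 + u) := by ring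
  rw [cpow_def_of_ne_zero (by exact_mod_cast h1.ne'), cpow_def_of_ne_zero (by exact_mod_cast h2.ne'),
    ← ofReal_log h1.le, ← ofReal_log h2.le, h3, Real.rpow_def_of_pos (mul_pos h1 h2),
    Real.log_mul h1.ne' h2.ne', Real.log_div h1.ne' h2.ne', ofReal_exp, ← Complex.exp_add,
    ← Complex.exp_add]
  push_cast
  ring_nf

/-- After the substitution `t = x (1 - u) / 2` the convolution of two Gamma densities with the rates
`w - i` and `w + i` and exponents adding up to `1` becomes `exp (-wx)` times the integral in the
kernel of `V`. -/
theorem integral_gamma_convolution (w l : ℝ) {x : ℝ} (hx : 0 < x) :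
    ∫ t in (0 : ℝ)..x, ((t : ℂ) ^ ((1 / 2 + I * l : ℂ) - 1) * cexp (-((w - I) * t))) *
      (((x - t : ℝ) : ℂ) ^ ((1 / 2 - I * l : ℂ) - 1) * cexp (-((w + I) * ((x - t : ℝ) : ℂ)))) =
    (Real.exp (-w * x) : ℂ) * kerInner l x := by
  have hx2 : x / 2 ≠ 0 := by positivity
  have h := intervalIntegral.integral_comp_sub_mul (a := -1) (b := 1) (fun t : ℝ =>
    ((t : ℂ) ^ ((1 / 2 + I * l : ℂ) - 1) * cexp (-((w - I) * t))) *
      (((x - t : ℝ) : ℂ) ^ ((1 / 2 - I * l : ℂ) - 1) *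
        cexp (-((w + I) * ((x - t : ℝ) : ℂ))))) hx2 (x / 2)
  rw [show x / 2 - x / 2 * 1 = 0 by ring, show x / 2 - x / 2 * -1 = x by ring, eq_comm,
    inv_smul_eq_iff₀ hx2] at h
  rw [h, kerInner, ← intervalIntegral.integral_smul, ← intervalIntegral.integral_const_mul,
    intervalIntegral.integral_of_le (by norm_num), intervalIntegral.integral_of_le (by norm_num),
    integral_Ioc_eq_integral_Ioo, integral_Ioc_eq_integral_Ioo]
  refine setIntegral_congr_fun measurableSet_Ioo fun u hu => ?_
  have h1 : 0 < 1 - u := by linarith [hu.2]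
  have h2 : 0 < 1 + u := by linarith [hu.1]
  have hc : ((x / 2 : ℝ) : ℂ) ≠ 0 := by exact_mod_cast hx2
  rw [show x / 2 - x / 2 * u = x / 2 * (1 - u) by ring,
    show x - x / 2 * (1 - u) = x / 2 * (1 + u) by ring, ofReal_mul, ofReal_mul (x / 2) (1 + u),
    mul_cpow_ofReal_nonneg (by positivity) h1.le, mul_cpow_ofReal_nonneg (by positivity) h2.le,
    show (1 / 2 + I * l : ℂ) - 1 = -(1 / 2) + I * l by ring,
    show (1 / 2 - I * l : ℂ) - 1 = -(1 / 2) - I * l by ring]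
  have e1 : ((x / 2 : ℝ) : ℂ) ^ (-(1 / 2) + I * l : ℂ) *
      ((x / 2 : ℝ) : ℂ) ^ (-(1 / 2) - I * l : ℂ) * ((x / 2 : ℝ) : ℂ) = 1 := by
    rw [← cpow_add _ _ hc, show (-(1 / 2) + I * l + (-(1 / 2) - I * l) : ℂ) = -1 by ring,
      cpow_neg_one, inv_mul_cancel₀ hc]
  have e2 : cexp (-((w - I) * (((x / 2 : ℝ) : ℂ) * ((1 - u : ℝ) : ℂ)))) *
      cexp (-((w + I) * (((x / 2 : ℝ) : ℂ) * ((1 + u : ℝ) : ℂ)))) =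
      (Real.exp (-w * x) : ℂ) * cexp (-(I * x * u)) := by
    rw [ofReal_exp, ← Complex.exp_add, ← Complex.exp_add]
    push_cast
    ring_nf
  have e3 := one_sub_cpow_mul_one_add_cpow l hu
  rw [real_smul]
  generalize ((x / 2 : ℝ) : ℂ) ^ (-(1 / 2) + I * l : ℂ) = P at *
  generalize ((x / 2 : ℝ) : ℂ) ^ (-(1 / 2) - I * l : ℂ) = Q at *
  generalize ((1 - u : ℝ) : ℂ) ^ (-(1 / 2) + I * l : ℂ) = R at *
  generalize ((1 + u : ℝ) : ℂ) ^ (-(1 / 2) - I * l : ℂ) = S at *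
  generalize cexp (-((w - I) * (((x / 2 : ℝ) : ℂ) * ((1 - u : ℝ) : ℂ)))) = E at *
  generalize cexp (-((w + I) * (((x / 2 : ℝ) : ℂ) * ((1 + u : ℝ) : ℂ)))) = F at *
  rw [mul_assoc (cexp _), ← e3]
  calc ((x / 2 : ℝ) : ℂ) * (P * R * E * (Q * S * F))
      = (P * Q * ((x / 2 : ℝ) : ℂ)) * ((E * F) * (R * S)) := by ring
    _ = _ := by rw [e1, e2]; ring

/-- The Laplace transform of a convolution is the product of the Laplace transforms; the Gamma
factors combine to `Γ(1/2 + il) Γ(1/2 - il) = π / cosh (πl)`. -/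
theorem integral_exp_mul_kerInner {w : ℝ} (hw : 0 < w) (l : ℝ) :
    ∫ x in Ioi (0 : ℝ), (Real.exp (-w * x) : ℂ) * kerInner l x =
      ((w - I : ℂ) ^ (-(1 / 2 + I * l)) * (w + I : ℂ) ^ (-(1 / 2 - I * l))) *
        (π / Real.cosh (π * l) : ℝ) := by
  have ha : 0 < (1 / 2 + I * l : ℂ).re := by simp
  have hb : 0 < (1 / 2 - I * l : ℂ).re := by simp
  have hA : 0 < (w - I : ℂ).re := by simpa
  have hB : 0 < (w + I : ℂ).re := by simpa
  have h := integral_posConvolution (integrableOn_cpow_mul_exp_neg_mul ha hA)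
    (integrableOn_cpow_mul_exp_neg_mul hb hB) (ContinuousLinearMap.mul ℝ ℂ)
  simp_rw [ContinuousLinearMap.mul_apply'] at h
  rw [setIntegral_congr_fun measurableSet_Ioi fun x hx => integral_gamma_convolution w l hx,
    integral_cpow_mul_exp_neg_mul_Ioi_of_re_pos ha hA,
    integral_cpow_mul_exp_neg_mul_Ioi_of_re_pos hb hB] at h
  have hG := Complex.Gamma_mul_Gamma_one_sub (1 / 2 + I * l)
  rw [show (1 : ℂ) - (1 / 2 + I * l) = 1 / 2 - I * l by ring,
    show (π : ℂ) * (1 / 2 + I * l) = (π * l : ℂ) * I + π / 2 by ring, Complex.sin_add_pi_div_two,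
    Complex.cos_mul_I] at hG
  rw [h, mul_mul_mul_comm, hG]
  push_cast
  rfl

theorem log_ofReal_add_I {w : ℝ} (hw : 0 < w) : Complex.log (w + I) =
    (Real.log √(1 + w ^ 2) : ℂ) + ((π / 2 - Real.arctan w : ℝ) : ℂ) * I := by
  have harg : (w + I : ℂ).arg = π / 2 - Real.arctan w := by
    rw [← Real.arctan_inv_of_pos hw, arg_of_re_nonneg (by simpa using hw.le), Real.arctan_eq_arcsin]
    congr 1
    have h1 : ‖(w + I : ℂ)‖ = w * √(1 + w⁻¹ ^ 2) := by
      rw [Complex.norm_def, normSq_apply, ← Real.sqrt_sq hw.le, ← Real.sqrt_mul (by positivity),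
        Real.sqrt_sq hw.le]
      congr 1
      simp
      field_simp
    rw [h1]
    simp
    field_simp
  have hnorm : ‖(w + I : ℂ)‖ = √(1 + w ^ 2) := by
    rw [Complex.norm_def, normSq_apply]
    congr 1
    simp
    ring
  rw [Complex.log, hnorm, harg]

theorem log_ofReal_sub_I {w : ℝ} (hw : 0 < w) : Complex.log (w - I) =
    (Real.log √(1 + w ^ 2) : ℂ) - ((π / 2 - Real.arctan w : ℝ) : ℂ) * I := by
  have hconj : (w - I : ℂ) = (starRingEnd ℂ) (w + I : ℂ) := by simp [sub_eq_add_neg]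
  have hargne : (w + I : ℂ).arg ≠ π :=
    (Complex.arg_lt_pi_iff.2 (Or.inl (by simpa using hw.le))).ne
  rw [hconj, log_conj _ hargne, log_ofReal_add_I hw]
  simp only [map_add, map_mul, conj_ofReal, conj_I]
  ring

theorem cpow_mul_cpow_eq {w : ℝ} (hw : 0 < w) (l : ℝ) :
    (w - I : ℂ) ^ (-(1 / 2 + I * l)) * (w + I : ℂ) ^ (-(1 / 2 - I * l)) =
      (((√(1 + w ^ 2))⁻¹ * Real.exp (2 * l * (Real.arctan w - π / 2)) : ℝ) : ℂ) := by
  have hne : (w + I : ℂ) ≠ 0 := fun h => by simpa using congrArg im h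
  have hne' : (w - I : ℂ) ≠ 0 := fun h => by simpa using congrArg im h
  rw [cpow_def_of_ne_zero hne, cpow_def_of_ne_zero hne', log_ofReal_sub_I hw, log_ofReal_add_I hw,
    ← Complex.exp_add]
  have h2 : (√(1 + w ^ 2))⁻¹ = Real.exp (-Real.log √(1 + w ^ 2)) := by
    rw [Real.exp_neg, Real.exp_log (by positivity)]
  rw [h2, ← Real.exp_add, ofReal_exp]
  congr 1
  push_cast
  linear_combination (2 * (l : ℂ) * (π / 2 - Complex.arctan w)) * I_sq

/-- The Laplace transform of `x ↦ q₊(s,x)` at `w` is the function corresponding to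
`x ↦ exp (-wx)` under `V`. -/
theorem integral_exp_mul_kernelQ {w s : ℝ} (hw : 0 < w) (hs : s ∈ Ioo (0 : ℝ) 1) :
    ∫ x in Ioi (0 : ℝ), (Real.exp (-w * x) : ℂ) * kernelQ s x = (kerUnit w s : ℂ) := by
  simp_rw [kernelQ_eq, mul_left_comm (ofReal (Real.exp _))]
  rw [integral_const_mul, integral_exp_mul_kerInner hw, cpow_mul_cpow_eq hw, ← ofReal_mul,
    ← ofReal_mul]
  congr 1
  have hπ := Real.pi_pos
  have h0 : 0 < s := hs.1
  have h1 : 0 < 1 - s := sub_pos.2 hs.2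
  have h3 : (1 : ℝ) / s - 1 = (1 - s) / s := by field_simp
  have hl : π * (Real.log (1 / s - 1) / (2 * π)) = Real.log (1 / s - 1) / 2 := by field_simp
  have hcosh : Real.cosh (Real.log (1 / s - 1) / 2) = 1 / 2 * (s ^ (-(1 / 2) : ℝ) *
      (1 - s) ^ (-(1 / 2) : ℝ)) := by
    have e1 : s * (s ^ (-(1 / 2) : ℝ) * (1 - s) ^ (-(1 / 2) : ℝ)) =
        Real.exp (-(Real.log (1 / s - 1) / 2)) := by
      nth_rw 1 [← Real.exp_log h0]
      rw [h3, Real.log_div h1.ne' h0.ne', Real.rpow_def_of_pos h0, Real.rpow_def_of_pos h1,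
        ← Real.exp_add, ← Real.exp_add]
      ring_nf
    have e2 : (1 - s) * (s ^ (-(1 / 2) : ℝ) * (1 - s) ^ (-(1 / 2) : ℝ)) =
        Real.exp (Real.log (1 / s - 1) / 2) := by
      nth_rw 1 [← Real.exp_log h1]
      rw [h3, Real.log_div h1.ne' h0.ne', Real.rpow_def_of_pos h0, Real.rpow_def_of_pos h1,
        ← Real.exp_add, ← Real.exp_add]
      ring_nf
    rw [Real.cosh_eq, ← e1, ← e2]
    ring
  have hexp : Real.exp (2 * (Real.log (1 / s - 1) / (2 * π)) * (Real.arctan w - π / 2)) =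
      (1 - s) ^ (Real.arctan w / π - 1 / 2) * s ^ (-(Real.arctan w / π) + 1 / 2) := by
    rw [h3, Real.log_div h1.ne' h0.ne', Real.rpow_def_of_pos h0, Real.rpow_def_of_pos h1,
      ← Real.exp_add]
    congr 1
    field_simp
    ring
  have hpi : π ^ (-(3 / 2 : ℝ)) = π⁻¹ * (√π)⁻¹ := by
    rw [Real.sqrt_eq_rpow, ← Real.rpow_neg hπ.le, ← Real.rpow_neg_one, ← Real.rpow_add hπ]
    norm_num
  have hs2 : s ^ (1 / 2 : ℝ) * s ^ (1 / 2 : ℝ) = s := by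
    rw [← Real.rpow_add h0]; norm_num
  have p1 := Real.rpow_pos_of_pos h0 (1 / 2)
  have p2 := Real.rpow_pos_of_pos h1 (1 / 2)
  rw [hl, hcosh, hexp, hpi, kerUnit, Real.rpow_add h0, Real.rpow_neg h0.le (1 / 2),
    Real.rpow_neg h1.le (1 / 2)]
  field_simp
  rw [sq, hs2]

/-! ### The integral transformation `V` -/

theorem stronglyMeasurable_kernelQ : StronglyMeasurable fun p : ℝ × ℝ => kernelQ p.1 p.2 := by
  have h : StronglyMeasurable fun p : ℝ × ℝ => ∫ u in Ioc (-1 : ℝ) 1,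
      cexp (-(I * p.2 * u)) * (((1 - u ^ 2) ^ (-(1 / 2 : ℝ)) : ℝ) : ℂ) *
        cexp (I / (2 * π) * Real.log (1 / p.1 - 1) * Real.log ((1 - u) / (1 + u))) := by
    refine StronglyMeasurable.integral_prod_right' (f := fun z : (ℝ × ℝ) × ℝ =>
      cexp (-(I * z.1.2 * z.2)) * (((1 - z.2 ^ 2) ^ (-(1 / 2 : ℝ)) : ℝ) : ℂ) *
        cexp (I / (2 * π) * Real.log (1 / z.1.1 - 1) * Real.log ((1 - z.2) / (1 + z.2)))) ?_
    exact Measurable.stronglyMeasurable (by fun_prop)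
  simp_rw [kernelQ, intervalIntegral.integral_of_le (show (-1 : ℝ) ≤ 1 by norm_num)]
  exact (Measurable.stronglyMeasurable (by fun_prop)).mul h

theorem norm_kerInner_le (l x : ℝ) :
    ‖kerInner l x‖ ≤ ∫ u in (-1 : ℝ)..1, |(1 - u ^ 2) ^ (-(1 / 2 : ℝ))| := by
  refine (intervalIntegral.norm_integral_le_integral_norm (by norm_num)).trans (le_of_eq ?_)
  congr 1
  funext u
  rw [norm_mul, norm_mul, Complex.norm_real, Real.norm_eq_abs, Complex.norm_exp, Complex.norm_exp]
  simp

theorem exists_norm_kernelQ_le {c d : ℝ} (hc : 0 < c) (hd : d < 1) :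
    ∃ C, ∀ s ∈ Ioc c d, ∀ x, ‖kernelQ s x‖ ≤ C := by
  refine ⟨1 / 2 * π ^ (-(3 / 2 : ℝ)) * c⁻¹ * (1 - d) ^ (-(1 / 2 : ℝ)) *
    ∫ u in (-1 : ℝ)..1, |(1 - u ^ 2) ^ (-(1 / 2 : ℝ))|, fun s hs x => ?_⟩
  have h0 : 0 < s := hc.trans hs.1
  have h1 : 0 < 1 - d := by linarith
  have h2 : 1 - d ≤ 1 - s := by linarith [hs.2]
  rw [kernelQ_eq, norm_mul, Complex.norm_real, Real.norm_eq_abs,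
    abs_of_nonneg (by have := h1.trans_le h2; positivity)]
  refine mul_le_mul ?_ (norm_kerInner_le _ _) (norm_nonneg _) (by positivity)
  refine mul_le_mul ?_ (Real.rpow_le_rpow_of_nonpos h1 h2 (by norm_num)) (by
    have := h1.trans_le h2; positivity) (by positivity)
  exact mul_le_mul_of_nonneg_left (inv_anti₀ hc hs.1.le) (by positivity)

theorem integrableOn_coeFn_unit (h : L2Unit) {c d : ℝ} (hc : 0 < c) (hd : d < 1) :
    IntegrableOn h (Ioc c d) := by
  have h1 : IntegrableOn h (Ioo 0 1) := (Lp.memLp h).integrable one_le_two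
  exact h1.mono_set fun s hs => ⟨hc.trans hs.1, hs.2.trans_lt hd⟩

theorem integrable_exp_mul_kernelQ_mul (h : L2Unit) {c d w : ℝ} (hc : 0 < c) (hd : d < 1)
    (hw : 0 < w) : Integrable (Function.uncurry fun x s : ℝ =>
      (Real.exp (-w * x) : ℂ) * (kernelQ s x * h s))
      ((volume.restrict (Ioi (0 : ℝ))).prod (volume.restrict (Ioc c d))) := by
  obtain ⟨C, hC⟩ := exists_norm_kernelQ_le hc hd
  have h1 : Integrable (fun x : ℝ => Real.exp (-w * x)) (volume.restrict (Ioi (0 : ℝ))) :=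
    integrableOn_exp_mul_Ioi (by linarith) 0
  have h2 : Integrable (fun s => C * ‖h s‖) (volume.restrict (Ioc c d)) :=
    ((integrableOn_coeFn_unit h hc hd).norm).const_mul C
  refine (h1.mul_prod h2).mono' ?_ ?_
  · have hm := (Lp.stronglyMeasurable h).measurable
    have hq : Measurable fun z : ℝ × ℝ => kernelQ z.2 z.1 :=
      stronglyMeasurable_kernelQ.measurable.comp measurable_swap
    refine Measurable.aestronglyMeasurable ?_
    exact (by fun_prop : Measurable fun z : ℝ × ℝ =>
      (Real.exp (-w * z.1) : ℂ) * (kernelQ z.2 z.1 * h z.2))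
  · rw [Measure.prod_restrict]
    filter_upwards [ae_restrict_mem (measurableSet_Ioi.prod measurableSet_Ioc)] with z hz
    rw [Function.uncurry, norm_mul, norm_mul, Complex.norm_real, Real.norm_eq_abs,
      abs_of_pos (Real.exp_pos _)]
    gcongr
    exact hC _ hz.2 _

theorem integral_exp_mul_truncated (h : L2Unit) {c d w : ℝ} (hc : 0 < c) (hcd : c ≤ d) (hd : d < 1)
    (hw : 0 < w) :
    ∫ x in Ioi (0 : ℝ), (Real.exp (-w * x) : ℂ) * ∫ s in c..d, kernelQ s x * h s =
      ∫ s in Ioc c d, (kerUnit w s : ℂ) * h s := by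
  simp_rw [intervalIntegral.integral_of_le hcd, ← integral_const_mul]
  rw [integral_integral_swap (integrable_exp_mul_kernelQ_mul h hc hd hw)]
  refine setIntegral_congr_fun measurableSet_Ioc fun s hs => ?_
  simp_rw [← mul_assoc]
  rw [integral_mul_const, integral_exp_mul_kernelQ hw ⟨hc.trans hs.1, hs.2.trans_lt hd⟩]

/-- The truncation of `h` to `(c,d]`, as an element of `L²(0,1)`. -/
noncomputable def truncUnit (c d : ℝ) (h : L2Unit) : L2Unit :=
  ((Lp.memLp h).indicator (measurableSet_Ioc (a := c) (b := d))).toLp _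

theorem inner_kerLp_truncUnit (w : Ioi (0 : ℝ)) (h : L2Unit) {c d : ℝ} (hc : 0 < c) (hd : d < 1) :
    inner ℂ (kerLp w) (truncUnit c d h) = ∫ s in Ioc c d, (kerUnit w s : ℂ) * h s := by
  rw [kerLp, truncUnit, inner_toLp_ofReal_toLp]
  simp_rw [← Set.indicator_mul_right _ (fun s => (kerUnit w s : ℂ))]
  have hsub : Ioc c d ⊆ Ioo 0 1 := fun s hs => ⟨hc.trans hs.1, hs.2.trans_lt hd⟩
  rw [setIntegral_indicator measurableSet_Ioc, inter_eq_self_of_subset_right hsub]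

/-- For functions supported in a compact subinterval of `(0,1)` the transformation `V` is given by
an absolutely convergent integral, since both sides have the same Laplace transform. -/
theorem coeFn_apply_truncUnit {V : L2Unit ≃ₗᵢ[ℂ] L2Pos} (hV : ∀ w, V (kerLp w) = expPos w)
    (h : L2Unit) {c d : ℝ} (hc : 0 < c) (hcd : c ≤ d) (hd : d < 1) :
    V (truncUnit c d h) =ᵐ[volume.restrict (Ioi (0 : ℝ))]
      fun x => ∫ s in c..d, kernelQ s x * h s := by
  set g : ℝ → ℂ := fun x => ∫ s in c..d, kernelQ s x * h s with hg
  obtain ⟨C, hC⟩ := exists_norm_kernelQ_le hc hd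
  have hgm : StronglyMeasurable g := by
    simp_rw [hg, intervalIntegral.integral_of_le hcd]
    refine StronglyMeasurable.integral_prod_right' (f := fun z : ℝ × ℝ => kernelQ z.2 z.1 * h z.2)
      (StronglyMeasurable.mul ?_ ((Lp.stronglyMeasurable h).comp_measurable measurable_snd))
    exact stronglyMeasurable_kernelQ.comp_measurable measurable_swap
  have hgb : ∀ x, ‖g x‖ ≤ ∫ s in Ioc c d, C * ‖h s‖ := by
    intro x
    simp only [hg, intervalIntegral.integral_of_le hcd]
    refine norm_integral_le_of_norm_le ((integrableOn_coeFn_unit h hc hd).norm.const_mul C) ?_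
    filter_upwards [ae_restrict_mem measurableSet_Ioc] with s hs
    rw [norm_mul]
    gcongr
    exact hC s hs x
  have hgL : ∀ w : ℝ, 0 < w → MemLp (fun x => (Real.exp (-w * x) : ℂ) * g x) 2
      (volume.restrict (Ioi (0 : ℝ))) := fun w hw =>
    (memLp_exp_neg hw).of_le_mul (c := ∫ s in Ioc c d, C * ‖h s‖)
      ((by fun_prop : Continuous fun x : ℝ => (Real.exp (-w * x) : ℂ)).stronglyMeasurable.mul
        hgm).aestronglyMeasurable
      (.of_forall fun x => by
        rw [norm_mul, mul_comm]
        gcongr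
        exact hgb x)
  -- the damped difference is square integrable and orthogonal to all exponentials
  have hVL : MemLp (fun x : ℝ => (Real.exp (-1 * x) : ℂ) * V (truncUnit c d h) x) 2
      (volume.restrict (Ioi (0 : ℝ))) := by
    refine (Lp.memLp (V (truncUnit c d h))).of_le
      ((by fun_prop : Continuous fun x : ℝ => (Real.exp (-1 * x) : ℂ)).aestronglyMeasurable.mul
        (Lp.aestronglyMeasurable _)) ?_
    filter_upwards [ae_restrict_mem measurableSet_Ioi] with x hx
    rw [norm_mul, Complex.norm_real, Real.norm_eq_abs, abs_of_pos (Real.exp_pos _)]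
    refine mul_le_of_le_one_left (norm_nonneg _) (Real.exp_le_one_iff.2 ?_)
    linarith [mem_Ioi.1 hx]
  have hf := (hVL.sub (hgL 1 one_pos))
  have hmul : ∀ (w x : ℝ) (y z : ℂ), (Real.exp (-w * x) : ℂ) * ((Real.exp (-1 * x) : ℂ) * y -
      (Real.exp (-1 * x) : ℂ) * z) =
      (Real.exp (-(w + 1) * x) : ℂ) * y - (Real.exp (-(w + 1) * x) : ℂ) * z := by
    intro w x y z
    rw [show -(w + 1) * x = -w * x + -1 * x by ring, Real.exp_add, ofReal_mul]
    ring
  have hzero : hf.toLp _ = 0 := by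
    refine eq_zero_of_inner_expPos fun w => ?_
    have hw : (0 : ℝ) < w + 1 := by linarith [mem_Ioi.1 w.2]
    rw [expPos, inner_toLp_ofReal_toLp]
    simp only [Pi.sub_apply, hmul]
    have i1 := integrable_ofReal_mul (memLp_exp_neg hw) (V (truncUnit c d h))
    have i2 : Integrable (fun x : ℝ => (Real.exp (-(w + 1) * x) : ℂ) * g x)
        (volume.restrict (Ioi (0 : ℝ))) := by
      have hI : Integrable (fun x : ℝ => (Real.exp (-(w + 1) * x) : ℂ))
        (volume.restrict (Ioi (0 : ℝ))) := (integrableOn_exp_mul_Ioi (by linarith) 0).ofReal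
      exact hI.mul_bdd hgm.aestronglyMeasurable (.of_forall hgb)
    rw [integral_sub i1 i2, integral_exp_mul_truncated h hc hcd hd hw,
      ← inner_expPos ⟨(w : ℝ) + 1, hw⟩, ← hV, V.inner_map_map, inner_kerLp_truncUnit _ h hc hd,
      sub_self]
  have hae := (Lp.eq_zero_iff_ae_eq_zero.1 hzero)
  filter_upwards [hae, hf.coeFn_toLp] with x h1 h2
  rw [h2] at h1
  have h3 : (Real.exp (-1 * x) : ℂ) * (V (truncUnit c d h) x - g x) = 0 := by
    rw [mul_sub]; exact h1
  exact sub_eq_zero.1 ((mul_eq_zero.1 h3).resolve_left (by exact_mod_cast (Real.exp_pos _).ne'))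

theorem tendsto_truncUnit (h : L2Unit) :
    Tendsto (fun a : ℝ × ℝ => ‖truncUnit a.1 (1 - a.2) h - h‖ₑ)
      (𝓝[>] (0 : ℝ) ×ˢ 𝓝[>] (0 : ℝ)) (𝓝 0) := by
  have hlim : Tendsto (fun a : ℝ × ℝ => ∫⁻ s in Ioo (0 : ℝ) 1,
      ‖(Ioc a.1 (1 - a.2)).indicator h s - h s‖ₑ ^ (2 : ℝ))
      (𝓝[>] (0 : ℝ) ×ˢ 𝓝[>] (0 : ℝ)) (𝓝 (∫⁻ _ in Ioo (0 : ℝ) 1, 0)) := by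
    have hm := (Lp.stronglyMeasurable h).measurable
    refine tendsto_lintegral_filter_of_dominated_convergence (fun s => ‖h s‖ₑ ^ (2 : ℝ)) ?_ ?_ ?_ ?_
    · exact .of_forall fun a => (((hm.indicator measurableSet_Ioc).sub hm).enorm).pow_const _
    · refine .of_forall fun a => .of_forall fun s => ?_
      by_cases hs : s ∈ Ioc a.1 (1 - a.2) <;> simp [hs]
    · have := (Lp.memLp h).eLpNorm_lt_top
      rw [eLpNorm_lt_top_iff_lintegral_rpow_enorm_lt_top two_ne_zero ENNReal.ofNat_ne_top] at this
      simpa using this.ne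
    · filter_upwards [ae_restrict_mem measurableSet_Ioo] with s hs
      refine tendsto_const_nhds.congr' ?_
      have h1 : ∀ᶠ a in 𝓝[>] (0 : ℝ), a < s := nhdsWithin_le_nhds (gt_mem_nhds hs.1)
      have h2 : ∀ᶠ a in 𝓝[>] (0 : ℝ), a < 1 - s :=
        nhdsWithin_le_nhds (gt_mem_nhds (sub_pos.2 hs.2))
      filter_upwards [h1.prod_mk h2] with a ha
      rw [Set.indicator_of_mem (show s ∈ Ioc a.1 (1 - a.2) from ⟨ha.1, by linarith [ha.2]⟩)]
      simp
  rw [lintegral_zero] at hlim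
  have hlim2 := (ENNReal.continuous_rpow_const (y := (1 / 2 : ℝ))).tendsto 0 |>.comp hlim
  rw [ENNReal.zero_rpow_of_pos (by norm_num)] at hlim2
  refine hlim2.congr fun a => ?_
  rw [Lp.enorm_def, eLpNorm_eq_lintegral_rpow_enorm_toReal two_ne_zero ENNReal.ofNat_ne_top,
    ENNReal.toReal_ofNat, Function.comp_apply]
  congr 1
  refine lintegral_congr_ae ?_
  filter_upwards [Lp.coeFn_sub (truncUnit a.1 (1 - a.2) h) h,
    ((Lp.memLp h).indicator (measurableSet_Ioc (a := a.1) (b := 1 - a.2))).coeFn_toLp] with s h1 h2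
  rw [h1, Pi.sub_apply, truncUnit, h2]

/-- A unitary map with the right values at the `kerLp w` is the integral transformation `V`: by
isometry its values at the truncations of `h` converge, and these values are the integrals. -/
theorem isTransformV_apply {V : L2Unit ≃ₗᵢ[ℂ] L2Pos} (hV : ∀ w, V (kerLp w) = expPos w)
    (h : L2Unit) :
    IsTransformV h (V h) := by
  refine (tendsto_truncUnit h).congr' ?_
  -- the bound `1 / 2` ensures that `a ≤ 1 - a'`
  have h1 : ∀ᶠ a in 𝓝[>] (0 : ℝ), 0 < a ∧ a < 1 / 2 := by
    filter_upwards [self_mem_nhdsWithin,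
      nhdsWithin_le_nhds (gt_mem_nhds (by norm_num : (0 : ℝ) < 1 / 2))] with a ha hb using ⟨ha, hb⟩
  filter_upwards [h1.prod_mk h1] with a ha
  rw [← V.enorm_map, map_sub, Lp.enorm_def]
  refine eLpNorm_congr_ae ?_
  filter_upwards [Lp.coeFn_sub (V (truncUnit a.1 (1 - a.2) h)) (V h),
    coeFn_apply_truncUnit hV h (c := a.1) (d := 1 - a.2) ha.1.1 (by linarith [ha.1.2, ha.2.2])
      (by linarith [ha.2.1])] with x h2 h3
  rw [h2, Pi.sub_apply, h3]

/-! ### The Fourier transforms of the exponentials -/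

section FourierTransform

open scoped FourierTransform SchwartzMap ContDiff

/-- On `L¹ ∩ L²` the inverse Fourier transformation of `L²` is given by the Fourier integral: both
define the same tempered distribution, by the duality formula for the Fourier integral. -/
theorem coeFn_fourierTransform_symm_toLp {f : ℝ → ℂ} (hf : MemLp f 2 volume) (hf1 : Integrable f) :
    (Lp.fourierTransformₗᵢ ℝ ℂ).symm (hf.toLp f) =ᵐ[volume] 𝓕⁻ f := by
  set G : L2Real := (Lp.fourierTransformₗᵢ ℝ ℂ).symm (hf.toLp f) with hG
  have hcont : Continuous (𝓕⁻ f) :=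
    VectorFourier.fourierIntegral_continuous Real.continuous_fourierChar
      (by exact continuous_inner.neg) hf1
  refine ae_eq_of_integral_contDiff_smul_eq ((Lp.memLp G).locallyIntegrable one_le_two)
    hcont.locallyIntegrable fun g hg hgs => ?_
  have hgs' : HasCompactSupport fun x => (g x : ℂ) := hgs.comp_left (g := ofReal) ofReal_zero
  have hg' : ContDiff ℝ ∞ fun x => (g x : ℂ) := ofRealCLM.contDiff.comp hg
  set φ : 𝓢(ℝ, ℂ) := hgs'.toSchwartzMap hg' with hφ
  have h1 := congrArg (fun T : 𝓢'(ℝ, ℂ) => T φ)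
    (Lp.fourierInv_toTemperedDistribution_eq (hf.toLp f))
  simp only [TemperedDistribution.fourierInv_apply, Lp.toTemperedDistribution_apply] at h1
  have h2 : ∫ x, (𝓕⁻ φ) x • (hf.toLp f) x = ∫ x, (𝓕⁻ φ) x • f x := by
    refine integral_congr_ae ?_
    filter_upwards [hf.coeFn_toLp] with x hx
    rw [hx]
  have h3 : ∫ x, (𝓕⁻ φ) x • f x = ∫ x, φ x • 𝓕⁻ f x := by
    have h4 := VectorFourier.integral_fourierIntegral_smul_eq_flip (L := -innerₗ ℝ)
      (e := Real.fourierChar) (μ := volume) (ν := volume) Real.continuous_fourierChar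
      (by exact continuous_inner.neg) φ.integrable hf1
    have hflip : (-innerₗ ℝ : ℝ →ₗ[ℝ] ℝ →ₗ[ℝ] ℝ).flip = -innerₗ ℝ := by
      ext; simp
    rw [hflip] at h4
    rw [SchwartzMap.fourierInv_coe]
    exact h4
  rw [h2, h3] at h1
  have h5 : ∀ x, φ x = (g x : ℂ) := fun x => rfl
  simp only [h5] at h1
  simp only [← Complex.coe_smul]
  exact h1.symm

theorem memLp_indicator_Ioi (g : L2Pos) : MemLp ((Ioi (0 : ℝ)).indicator g) 2 volume :=
  (memLp_indicator_iff_restrict measurableSet_Ioi).2 (Lp.memLp g)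

/-- The adjoint of the restriction to `ℝ₊` is the extension by `0`. -/
theorem adjoint_restrictPos_apply (g : L2Pos) :
    ContinuousLinearMap.adjoint restrictPos g = (memLp_indicator_Ioi g).toLp _ := by
  refine ext_inner_left ℂ fun f => ?_
  rw [ContinuousLinearMap.adjoint_inner_right, L2.inner_def, L2.inner_def,
    ← integral_indicator measurableSet_Ioi]
  have h1 : ∀ᵐ x : ℝ, x ∈ Ioi (0 : ℝ) → restrictPos f x = f x :=
    (ae_restrict_iff' measurableSet_Ioi).1 (LpToLpRestrictCLM_coeFn ℂ (Ioi (0 : ℝ)) f)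
  refine integral_congr_ae ?_
  filter_upwards [h1, (memLp_indicator_Ioi g).coeFn_toLp] with x hx hx2
  rw [hx2]
  by_cases h : x ∈ Ioi (0 : ℝ)
  · rw [Set.indicator_of_mem h, Set.indicator_of_mem h, hx h]
  · rw [Set.indicator_of_notMem h, Set.indicator_of_notMem h, inner_zero_right]

theorem norm_adjoint_restrictPos (g : L2Pos) :
    ‖ContinuousLinearMap.adjoint restrictPos g‖ = ‖g‖ := by
  rw [adjoint_restrictPos_apply, Lp.norm_toLp, Lp.norm_def,
    eLpNorm_indicator_eq_eLpNorm_restrict measurableSet_Ioi]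

theorem norm_fourierInv (f : L2Real) : ‖fourierInv f‖ = ‖f‖ := by
  change ‖weightedComp measurable_const (measurable_id.div_const _) dilation_map
    ((Lp.fourierTransformₗᵢ ℝ ℂ).symm f)‖ = ‖f‖
  rw [LinearIsometry.norm_map, LinearIsometryEquiv.norm_map]

theorem coeFn_weightedComp {E F : Type*} [MeasurableSpace E] [MeasurableSpace F] {μ : Measure E}
    {ν : Measure F} {w : E → ℂ} {T : E → F} (hw : Measurable w) (hT : Measurable T)
    (h : (μ.withDensity fun x => ‖w x‖ₑ ^ 2).map T = ν) {f : Lp ℂ 2 ν} {g : F → ℂ}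
    (hfg : f =ᵐ[ν] g) : weightedComp hw hT h f =ᵐ[μ] fun x => w x * g (T x) :=
  (memLp_weightedComp hw hT h f).coeFn_toLp.trans (weightedComp_congr hw hT h hfg)

theorem fourierInv_indicator_exp {w : ℝ} (hw : 0 < w) (x : ℝ) :
    𝓕⁻ ((Ioi (0 : ℝ)).indicator fun y => (Real.exp (-w * y) : ℂ)) x =
      1 / (w - 2 * π * x * I) := by
  rw [Real.fourierInv_eq']
  have h1 : ∀ y : ℝ, cexp (((2 * π * inner ℝ y x : ℝ) : ℂ) * I) •
      (Ioi (0 : ℝ)).indicator (fun y => (Real.exp (-w * y) : ℂ)) y =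
      (Ioi (0 : ℝ)).indicator (fun y : ℝ => cexp ((-w + 2 * π * x * I) * y)) y := by
    intro y
    by_cases h : y ∈ Ioi (0 : ℝ)
    · rw [Set.indicator_of_mem h, Set.indicator_of_mem h, smul_eq_mul, ofReal_exp,
        ← Complex.exp_add]
      congr 1
      simp
      ring
    · rw [Set.indicator_of_notMem h, Set.indicator_of_notMem h, smul_zero]
  simp_rw [h1]
  rw [integral_indicator measurableSet_Ioi, integral_exp_mul_complex_Ioi (by simpa using hw)]
  rw [ofReal_zero, mul_zero, Complex.exp_zero, neg_div, ← div_neg]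
  congr 1
  ring

theorem coeFn_fourierInv_expPos (w : Ioi (0 : ℝ)) :
    fourierInv (ContinuousLinearMap.adjoint restrictPos (expPos w)) =ᵐ[volume]
      fun x => (((2 * π) ^ (-(1 / 2 : ℝ)) : ℝ) : ℂ) * (1 / ((w : ℝ) - x * I)) := by
  have hw : (0 : ℝ) < w := w.2
  set f : ℝ → ℂ := (Ioi (0 : ℝ)).indicator fun y => (Real.exp (-w * y) : ℂ) with hfdef
  have hf2 : MemLp f 2 volume := (memLp_indicator_iff_restrict measurableSet_Ioi).2
    (memLp_exp_neg hw)
  have hf1 : Integrable f := (integrable_indicator_iff measurableSet_Ioi).2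
    (integrableOn_exp_mul_Ioi (by linarith) 0).ofReal
  have h1 : ContinuousLinearMap.adjoint restrictPos (expPos w) = hf2.toLp f := by
    rw [adjoint_restrictPos_apply]
    refine MemLp.toLp_congr _ _ ?_
    have : ∀ᵐ x : ℝ, x ∈ Ioi (0 : ℝ) → expPos w x = (Real.exp (-w * x) : ℂ) :=
      (ae_restrict_iff' measurableSet_Ioi).1 (memLp_exp_neg hw).coeFn_toLp
    filter_upwards [this] with x hx
    by_cases h : x ∈ Ioi (0 : ℝ)
    · rw [Set.indicator_of_mem h, hfdef, Set.indicator_of_mem h, hx h]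
    · rw [Set.indicator_of_notMem h, hfdef, Set.indicator_of_notMem h]
  rw [h1]
  refine (coeFn_weightedComp measurable_const (measurable_id.div_const _) dilation_map
    (coeFn_fourierTransform_symm_toLp hf2 hf1)).trans (.of_forall fun x => ?_)
  simp only
  rw [hfdef, fourierInv_indicator_exp hw]
  congr 3
  push_cast
  have : (π : ℂ) ≠ 0 := by exact_mod_cast Real.pi_ne_zero
  field_simp
  rfl

/-! ### The image of the exponentials in `L²(𝕋)` -/

/-- The isometry `X 𝓕⁻¹ P₊*` from `L²(ℝ₊)` into `L²(𝕋)`. -/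
noncomputable def embedPos (α : ℝ) {δ : ℝ} (hδ : 0 < δ) : L2Pos →L[ℂ] L2Torus :=
  opX α hδ ∘L fourierInv ∘L ContinuousLinearMap.adjoint restrictPos

theorem norm_embedPos (α : ℝ) {δ : ℝ} (hδ : 0 < δ) (f : L2Pos) : ‖embedPos α hδ f‖ = ‖f‖ := by
  change ‖weightedComp (measurable_moebiusWeight α δ) (measurable_moebiusInv α δ)
    (moebius_map α hδ) (fourierInv _)‖ = ‖f‖
  rw [LinearIsometry.norm_map, norm_fourierInv]
  exact norm_adjoint_restrictPos f

theorem norm_torusPoint (θ : Torus) : ‖torusPoint θ‖ = 1 := Circle.norm_coe _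

theorem ae_torusPoint_ne (z : ℂ) : ∀ᵐ θ ∂torusMeasure, torusPoint θ ≠ z := by
  have hsub : {θ : Torus | torusPoint θ = z}.Subsingleton := fun a ha b hb =>
    AddCircle.injective_toCircle Real.two_pi_pos.ne' (Circle.coe_injective (ha.trans hb.symm))
  have hnt : Nontrivial Torus := by
    have : Nontrivial Circle := ⟨1, -1, fun h => by
      have := congrArg ((↑) : Circle → ℂ) h
      norm_num at this⟩
    exact (AddCircle.homeomorphCircle Real.two_pi_pos.ne').toEquiv.nontrivial
  have := hsub.measure_zero torusMeasure
  rw [ae_iff]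
  simpa using this

theorem moebiusInv_eq_re (α δ : ℝ) {z : ℂ} (hz : ‖z‖ = 1) :
    ((moebiusInv α δ z).re : ℂ) = moebiusInv α δ z := by
  rw [← Complex.conj_eq_iff_re]
  by_cases h : -z + cexp (I * α) = 0
  · simp [moebiusInv, h]
  have hz0 : z ≠ 0 := fun h0 => by simp [h0] at hz
  have he : ‖cexp (I * α)‖ = 1 := by rw [mul_comm, Complex.norm_exp_ofReal_mul_I]
  have hz' : (starRingEnd ℂ) z = z⁻¹ := (Complex.inv_eq_conj hz).symm
  have he' : (starRingEnd ℂ) (cexp (I * α)) = (cexp (I * α))⁻¹ := (Complex.inv_eq_conj he).symm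
  have he0 := Complex.exp_ne_zero (I * α)
  have h' : -z⁻¹ + (cexp (I * α))⁻¹ ≠ 0 := by
    intro h0
    apply h
    have : z = cexp (I * α) := by
      rw [neg_add_eq_zero] at h0
      exact inv_injective h0
    rw [this]; ring
  rw [moebiusInv, map_div₀, map_mul, map_mul, map_add, map_add, map_neg, conj_I, conj_ofReal, hz',
    he', div_eq_div_iff h' h]
  field_simp
  ring

theorem abs_cayley_lt_one {δ w : ℝ} (hδ : 0 < δ) (hw : 0 < w) : |(w - δ) / (w + δ)| < 1 := by
  rw [abs_div, abs_of_pos (by linarith : 0 < w + δ), div_lt_one (by linarith), abs_lt]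
  constructor <;> linarith

/-- Substituting `x = χ⁻¹(z)` in the Fourier transform `(w - ix)⁻¹` and multiplying by the weight of
`X` gives a multiple of the sum of a geometric series in `z`. -/
theorem coeFn_embedPos_expPos (α : ℝ) {δ : ℝ} (hδ : 0 < δ) (w : Ioi (0 : ℝ)) :
    embedPos α hδ (expPos w) =ᵐ[torusMeasure] fun θ => ((√(2 * δ) / (w + δ) : ℝ) : ℂ) *
      (1 - (((w - δ) / (w + δ) : ℝ) : ℂ) * cexp (-(I * α)) * torusPoint θ)⁻¹ := by
  have hw : (0 : ℝ) < w := w.2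
  refine (coeFn_weightedComp (measurable_moebiusWeight α δ) (measurable_moebiusInv α δ)
    (moebius_map α hδ) (coeFn_fourierInv_expPos w)).trans ?_
  filter_upwards [ae_torusPoint_ne (cexp (I * α))] with θ hθ
  have hsqrt : (√(2 * π) : ℂ) * (((2 * π) ^ (-(1 / 2 : ℝ)) : ℝ) : ℂ) = 1 := by
    rw [← ofReal_mul, Real.sqrt_eq_rpow, ← Real.rpow_add Real.two_pi_pos]
    norm_num
  rw [moebiusInv_eq_re α δ (norm_torusPoint θ), moebiusInv, moebiusWeight]
  have he : ‖cexp (I * α)‖ = 1 := by rw [mul_comm, Complex.norm_exp_ofReal_mul_I]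
  have hq := abs_cayley_lt_one hδ hw
  have hz := norm_torusPoint θ
  generalize torusPoint θ = z at *
  have he0 := Complex.exp_ne_zero (I * α)
  have hd : -z + cexp (I * α) ≠ 0 := fun h => hθ (by linear_combination -h)
  rw [Complex.exp_neg]
  have hwd : ((w : ℝ) + δ : ℂ) ≠ 0 := by exact_mod_cast (by linarith : (w : ℝ) + δ ≠ 0)
  have hne : 1 - (((w - δ) / (w + δ) : ℝ) : ℂ) * (cexp (I * α))⁻¹ * z ≠ 0 := by
    intro h
    have h2 : ‖(((w - δ) / (w + δ) : ℝ) : ℂ) * (cexp (I * α))⁻¹ * z‖ = 1 := by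
      rw [← sub_eq_zero.1 h, norm_one]
    rw [norm_mul, norm_mul, norm_inv, he, hz, Complex.norm_real, Real.norm_eq_abs] at h2
    simp only [inv_one, mul_one] at h2
    linarith
  generalize cexp (I * α) = c at *
  have hden : ((w : ℝ) - I * δ * (z + c) / (-z + c) * I : ℂ) =
      (w + δ) * c * (1 - (((w - δ) / (w + δ) : ℝ) : ℂ) * c⁻¹ * z) / (-z + c) := by
    push_cast
    field_simp
    linear_combination (-(δ : ℂ) * (z + c)) * I_sq
  rw [hden]
  generalize (((2 * π) ^ (-(1 / 2 : ℝ)) : ℝ) : ℂ) = b at *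
  rw [ofReal_div (√(2 * δ)), ofReal_add]
  generalize 1 - (((w - δ) / (w + δ) : ℝ) : ℂ) * c⁻¹ * z = N at *
  field_simp
  linear_combination (√(2 * δ) : ℂ) * hsqrt

end FourierTransform

/-! ### The map `X₊` is unitary -/

theorem hasSum_pow_smul_fourierLp {c : ℂ} (hc : ‖c‖ < 1) {G : L2Torus}
    (hG : G =ᵐ[torusMeasure] fun θ => (1 - c * torusPoint θ)⁻¹) :
    HasSum (fun n : ℕ => c ^ n • (fourierLp 2 (n : ℤ) : L2Torus)) G := by
  have hnorm : ∀ n : ℕ, ‖c ^ n • (fourierLp 2 (n : ℤ) : L2Torus)‖ = ‖c‖ ^ n := by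
    intro n
    rw [norm_smul, norm_pow, orthonormal_fourier.1, mul_one]
  have hgeo := summable_geometric_of_lt_one (norm_nonneg c) hc
  have hsumm : Summable fun n : ℕ => c ^ n • (fourierLp 2 (n : ℤ) : L2Torus) :=
    Summable.of_norm (by simpa only [hnorm] using hgeo)
  have hfin : ∑' n : ℕ, ‖c ^ n • (fourierLp 2 (n : ℤ) : L2Torus)‖ₑ ≠ ∞ := by
    simpa only [← ofReal_norm, hnorm] using hgeo.tsum_ofReal_ne_top
  have hco : ∀ᵐ θ ∂torusMeasure, ∀ n : ℕ,
      (c ^ n • (fourierLp 2 (n : ℤ) : L2Torus)) θ = (c * torusPoint θ) ^ n := by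
    rw [ae_all_iff]
    intro n
    filter_upwards [Lp.coeFn_smul (c ^ n) (fourierLp 2 (n : ℤ) : L2Torus),
      coeFn_fourierLp 2 (n : ℤ)] with θ h1 h2
    rw [h1, Pi.smul_apply, h2, fourier_apply, AddCircle.toCircle_zsmul, torusPoint, mul_pow,
      smul_eq_mul, zpow_natCast, Circle.coe_pow]
  have heq : ∑' n : ℕ, c ^ n • (fourierLp 2 (n : ℤ) : L2Torus) = G := by
    refine Lp.ext ?_
    filter_upwards [Lp.hasSum_coeFn_tsum hfin, hco, hG] with θ h1 h2 h3
    simp only [h2] at h1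
    rw [h3]
    refine h1.unique (hasSum_geometric_of_norm_lt_one ?_)
    rwa [norm_mul, norm_torusPoint, mul_one]
  rw [← heq]
  exact hsumm.hasSum

theorem hasSum_embedPos_expPos (α : ℝ) {δ : ℝ} (hδ : 0 < δ) (w : Ioi (0 : ℝ)) :
    HasSum (fun n : ℕ => ((((w - δ) / (w + δ) : ℝ) : ℂ) * cexp (-(I * α))) ^ n •
      (fourierLp 2 (n : ℤ) : L2Torus))
      ((((w + δ) / √(2 * δ) : ℝ) : ℂ) • embedPos α hδ (expPos w)) := by
  have hw : (0 : ℝ) < w := w.2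
  refine hasSum_pow_smul_fourierLp ?_ ?_
  · rw [norm_mul, Complex.norm_real, Real.norm_eq_abs, Complex.norm_exp]
    simpa using abs_cayley_lt_one hδ hw
  · filter_upwards [Lp.coeFn_smul (((w + δ) / √(2 * δ) : ℝ) : ℂ) (embedPos α hδ (expPos w)),
      coeFn_embedPos_expPos α hδ w] with θ h1 h2
    rw [h1, Pi.smul_apply, h2, smul_eq_mul, ← mul_assoc, ← ofReal_mul]
    have : (w + δ) / √(2 * δ) * (√(2 * δ) / (w + δ)) = 1 := by
      have : 0 < √(2 * δ) := by positivity
      have : 0 < w + δ := by positivity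
      field_simp
    rw [this, ofReal_one, one_mul]

theorem fourierLp_mem_hardy (n : ℕ) : (fourierLp 2 (n : ℤ) : L2Torus) ∈ hardy :=
  (hardyBasis n).2

theorem isClosed_hardy : IsClosed (hardy : Set L2Torus) :=
  Submodule.isClosed_topologicalClosure _

theorem embedPos_expPos_mem_hardy (α : ℝ) {δ : ℝ} (hδ : 0 < δ) (w : Ioi (0 : ℝ)) :
    embedPos α hδ (expPos w) ∈ hardy := by
  have hw : (0 : ℝ) < w := w.2
  have hc : (((w + δ) / √(2 * δ) : ℝ) : ℂ) ≠ 0 := by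
    have : 0 < (w + δ) / √(2 * δ) := by positivity
    exact_mod_cast this.ne'
  refine (Submodule.smul_mem_iff hardy hc).1 ?_
  exact isClosed_hardy.mem_of_tendsto (hasSum_embedPos_expPos α hδ w)
    (.of_forall fun s => Submodule.sum_mem _ fun n _ =>
      Submodule.smul_mem _ _ (fourierLp_mem_hardy n))

theorem embedPos_mem_hardy (α : ℝ) {δ : ℝ} (hδ : 0 < δ) (f : L2Pos) :
    embedPos α hδ f ∈ hardy := by
  have h : (Submodule.span ℂ (range expPos)).topologicalClosure ≤
      hardy.comap (embedPos α hδ : L2Pos →ₗ[ℂ] L2Torus) := by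
    refine Submodule.topologicalClosure_minimal _ (Submodule.span_le.2 ?_)
      (isClosed_hardy.preimage (embedPos α hδ).continuous)
    rintro _ ⟨w, rfl⟩
    exact embedPos_expPos_mem_hardy α hδ w
  rw [topologicalClosure_span_expPos] at h
  exact h (Submodule.mem_top : f ∈ _)

/-- Since `X 𝓕⁻¹ P₊*` takes its values in the Hardy space, the projection in the definition of `X₊`
acts as the identity. -/
theorem coe_opXPlus (α : ℝ) {δ : ℝ} (hδ : 0 < δ) (f : L2Pos) :
    (opXPlus α hδ f : L2Torus) = embedPos α hδ f := by
  change ((hardy.orthogonalProjectionOnto (embedPos α hδ f) : hardy) : L2Torus) = _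
  have := hardy.orthogonalProjectionOnto_mem_subspace_eq_self ⟨_, embedPos_mem_hardy α hδ f⟩
  exact congrArg Subtype.val this

theorem norm_opXPlus (α : ℝ) {δ : ℝ} (hδ : 0 < δ) (f : L2Pos) : ‖opXPlus α hδ f‖ = ‖f‖ := by
  rw [← norm_embedPos α hδ f, ← coe_opXPlus, Submodule.coe_norm]

theorem hasSum_opXPlus_expPos (α : ℝ) {δ : ℝ} (hδ : 0 < δ) (w : Ioi (0 : ℝ)) :
    HasSum (fun n : ℕ => ((((w - δ) / (w + δ) : ℝ) : ℂ) * cexp (-(I * α))) ^ n • hardyBasis n)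
      ((((w + δ) / √(2 * δ) : ℝ) : ℂ) • opXPlus α hδ (expPos w)) := by
  have h := (hardy.orthogonalProjectionOnto).hasSum (hasSum_embedPos_expPos α hδ w)
  simp only [map_smul] at h
  have h2 : ∀ n : ℕ, hardy.orthogonalProjectionOnto (fourierLp 2 (n : ℤ) : L2Torus) =
      hardyBasis n := fun n => hardy.orthogonalProjectionOnto_mem_subspace_eq_self (hardyBasis n)
  simp only [h2] at h
  exact h

/-- The parameter `w = δ (1 + q) / (1 - q)`, the inverse of the Cayley transformation
`q = (w - δ) / (w + δ)`, along the sequence `q = 1 / (k + 2)`. -/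
noncomputable def cayleySeq {δ : ℝ} (hδ : 0 < δ) (k : ℕ) : Ioi (0 : ℝ) :=
  ⟨δ * (1 + 1 / ((k : ℝ) + 2)) / (1 - 1 / ((k : ℝ) + 2)), by
    have h : 1 / ((k : ℝ) + 2) < 1 := by
      rw [div_lt_one (by positivity)]
      linarith [Nat.cast_nonneg (α := ℝ) k]
    exact div_pos (by positivity) (sub_pos.2 h)⟩

theorem cayleySeq_sub_div_add {δ : ℝ} (hδ : 0 < δ) (k : ℕ) :
    ((cayleySeq hδ k : ℝ) - δ) / (cayleySeq hδ k + δ) = 1 / ((k : ℝ) + 2) := by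
  have h : (1 : ℝ) - 1 / ((k : ℝ) + 2) ≠ 0 := by
    have h2 : (k : ℝ) + 2 - 1 ≠ 0 := by
      have := Nat.cast_nonneg (α := ℝ) k
      linarith
    field_simp
    exact div_ne_zero h2 (by positivity)
  rw [cayleySeq]
  simp only
  generalize 1 / ((k : ℝ) + 2) = q at *
  rw [div_eq_iff (by
    rw [div_add' _ _ _ h]
    have : δ * (1 + q) + δ * (1 - q) = 2 * δ := by ring
    rw [this]
    exact div_ne_zero (by positivity) h)]
  field_simp
  ring

theorem tendsto_one_div_add_two :
    Tendsto (fun k : ℕ => ((1 / ((k : ℝ) + 2) : ℝ) : ℂ)) atTop (𝓝[≠] 0) := by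
  refine tendsto_nhdsWithin_of_tendsto_nhds_of_eventually_within _ ?_ (.of_forall fun k => ?_)
  · have h : Tendsto (fun k : ℕ => 1 / ((k : ℝ) + 2)) atTop (𝓝 0) :=
      tendsto_const_nhds.div_atTop (tendsto_atTop_add_const_right _ _ tendsto_natCast_atTop_atTop)
    exact (Complex.continuous_ofReal.tendsto' 0 0 (by simp)).comp h
  · have : 0 < 1 / ((k : ℝ) + 2) := by positivity
    exact ofReal_ne_zero.2 this.ne'

theorem eq_zero_of_inner_hardyBasis {f : hardy} (hf : ∀ n, inner ℂ (hardyBasis n) f = 0) :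
    f = 0 := by
  have h1 : (f : L2Torus) ∈ (Submodule.span ℂ
      (range fun n : ℕ => (fourierLp 2 (n : ℤ) : L2Torus)))ᗮ := by
    rw [Submodule.mem_orthogonal]
    intro u hu
    induction hu using Submodule.span_induction with
    | mem x hx => obtain ⟨n, rfl⟩ := hx; exact hf n
    | zero => exact inner_zero_left _
    | add x y _ _ hx hy => rw [inner_add_left, hx, hy, add_zero]
    | smul a x _ hx => rw [inner_smul_left, hx, mul_zero]
  rw [← Submodule.orthogonal_closure] at h1
  have h2 := (Submodule.mem_orthogonal _ _).1 h1 f f.2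
  exact Subtype.ext (inner_self_eq_zero.1 h2)

/-- A function in the Hardy space that is orthogonal to all `X₊ exp (-wx)` has a vanishing
generating function of Fourier coefficients. -/
theorem eq_zero_of_inner_opXPlus_expPos (α : ℝ) {δ : ℝ} (hδ : 0 < δ) {f : hardy}
    (hf : ∀ w, inner ℂ f (opXPlus α hδ (expPos w)) = 0) : f = 0 := by
  refine eq_zero_of_inner_hardyBasis fun n => ?_
  have h := taylorCoeff_of_hasSum (a := fun n => cexp (-(I * α)) ^ n * inner ℂ f (hardyBasis n))
    (F := fun _ => 0) tendsto_one_div_add_two analyticAt_const (.of_forall fun k => by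
      have h1 := (innerSL ℂ f).hasSum (hasSum_opXPlus_expPos α hδ (cayleySeq hδ k))
      simp only [map_smul, innerSL_apply_apply, hf, mul_zero, cayleySeq_sub_div_add, mul_pow,
        smul_eq_mul, mul_assoc] at h1
      exact h1) n
  have h0 : taylorCoeff (fun _ => 0) n = 0 := by
    rw [taylorCoeff, iteratedDeriv_eq_iteratedFDeriv]
    simp
  rw [h0, eq_comm, mul_eq_zero] at h
  exact (inner_eq_zero_symm (𝕜 := ℂ) (E := hardy)).1
    (h.resolve_left (pow_ne_zero _ (Complex.exp_ne_zero _)))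

theorem exists_linearIsometryEquiv_opXPlus (α : ℝ) {δ : ℝ} (hδ : 0 < δ) :
    ∃ Φ : L2Pos ≃ₗᵢ[ℂ] hardy, ∀ f, Φ f = opXPlus α hδ f := by
  obtain ⟨Φ, hΦ⟩ := exists_linearIsometryEquiv_of_inner_eq topologicalClosure_span_expPos
    (v := fun w => opXPlus α hδ (expPos w))
    (topologicalClosure_span_eq_top_of_inner_eq_zero fun f hf =>
      eq_zero_of_inner_opXPlus_expPos α hδ fun w =>
        (inner_eq_zero_symm (𝕜 := ℂ) (E := hardy)).1 (hf w))
    (fun w v => (LinearIsometry.inner_map_map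
      (⟨(opXPlus α hδ : L2Pos →ₗ[ℂ] hardy), norm_opXPlus α hδ⟩ : L2Pos →ₗᵢ[ℂ] hardy) _ _).symm)
  refine ⟨Φ, fun f => ?_⟩
  have h : (Φ : L2Pos →L[ℂ] hardy) = opXPlus α hδ := by
    refine ContinuousLinearMap.ext_on
      (Submodule.dense_iff_topologicalClosure_eq_top.2 topologicalClosure_span_expPos) ?_
    rintro _ ⟨w, rfl⟩
    exact hΦ w
  exact congrArg (fun T : L2Pos →L[ℂ] hardy => T f) h

/-! ### The Toeplitz operator -/

theorem integral_inv_add_mul_I {w : ℝ} (hw : 0 < w) :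
    ∫ x in (-1 : ℝ)..1, ((w : ℂ) + x * I)⁻¹ = ((π - 2 * Real.arctan w : ℝ) : ℂ) := by
  have hre : ∀ x : ℝ, 0 < ((w : ℂ) + x * I).re := fun x => by simpa using hw
  have hne : ∀ x : ℝ, ((w : ℂ) + x * I) ≠ 0 := fun x h => by
    have := hre x
    rw [h] at this
    simp at this
  have hderiv : ∀ x ∈ uIcc (-1 : ℝ) 1, HasDerivAt (fun x : ℝ => -I * Complex.log ((w : ℂ) + x * I))
      (((w : ℂ) + x * I)⁻¹) x := by
    intro x _
    have h1 : HasDerivAt (fun x : ℝ => (w : ℂ) + x * I) I x := by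
      simpa using ((hasDerivAt_id x).ofReal_comp.mul_const I).const_add (w : ℂ)
    have h2 := (h1.clog_real (Or.inl (hre x))).const_mul (-I)
    rwa [div_eq_mul_inv, ← mul_assoc, neg_mul, I_mul_I, neg_neg, one_mul] at h2
  have hcont : ContinuousOn (fun x : ℝ => ((w : ℂ) + x * I)⁻¹) (uIcc (-1 : ℝ) 1) :=
    ContinuousOn.inv₀ (by fun_prop) fun x _ => hne x
  rw [intervalIntegral.integral_eq_sub_of_hasDerivAt hderiv hcont.intervalIntegrable]
  have e1 : ((w : ℂ) + ((1 : ℝ) : ℂ) * I) = w + I := by simp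
  have e2 : ((w : ℂ) + ((-1 : ℝ) : ℂ) * I) = w - I := by simp [sub_eq_add_neg]
  rw [e1, e2, log_ofReal_add_I hw, log_ofReal_sub_I hw]
  push_cast
  linear_combination (-(π : ℂ) + 2 * Complex.arctan w) * I_sq

theorem integral_inv_sub_mul_I {w : ℝ} (hw : 0 < w) :
    ∫ x in (-1 : ℝ)..1, ((w : ℂ) - x * I)⁻¹ = ((π - 2 * Real.arctan w : ℝ) : ℂ) := by
  rw [← integral_inv_add_mul_I hw]
  have h := intervalIntegral.integral_comp_neg (a := -1) (b := 1)
    fun x : ℝ => ((w : ℂ) + x * I)⁻¹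
  rw [neg_neg] at h
  rw [← h]
  congr 1
  funext x
  push_cast
  ring_nf

/-- By partial fractions `(w + ix)⁻¹ (v - ix)⁻¹ = (w + v)⁻¹ ((w + ix)⁻¹ + (v - ix)⁻¹)`. -/
theorem integral_inv_mul_inv {w v : ℝ} (hw : 0 < w) (hv : 0 < v) :
    ∫ x in Icc (-1 : ℝ) 1, ((w : ℂ) + x * I)⁻¹ * ((v : ℂ) - x * I)⁻¹ =
      ((2 * π * ((1 - (Real.arctan w / π + Real.arctan v / π)) / (w + v)) : ℝ) : ℂ) := by
  have hne : ∀ x : ℝ, ((w : ℂ) + x * I) ≠ 0 := fun x h => by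
    have := congrArg re h
    simp at this
    linarith
  have hne' : ∀ x : ℝ, ((v : ℂ) - x * I) ≠ 0 := fun x h => by
    have := congrArg re h
    simp at this
    linarith
  have hs : (w + v : ℂ) ≠ 0 := by exact_mod_cast (by linarith : w + v ≠ 0)
  have hpf : ∀ x : ℝ, ((w : ℂ) + x * I)⁻¹ * ((v : ℂ) - x * I)⁻¹ =
      (w + v : ℂ)⁻¹ * (((w : ℂ) + x * I)⁻¹ + ((v : ℂ) - x * I)⁻¹) := by
    intro x
    have := hne x
    have := hne' x
    field_simp
    ring
  have i1 : IntervalIntegrable (fun x : ℝ => ((w : ℂ) + x * I)⁻¹) volume (-1) 1 :=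
    ContinuousOn.intervalIntegrable (ContinuousOn.inv₀ (by fun_prop) fun x _ => hne x)
  have i2 : IntervalIntegrable (fun x : ℝ => ((v : ℂ) - x * I)⁻¹) volume (-1) 1 :=
    ContinuousOn.intervalIntegrable (ContinuousOn.inv₀ (by fun_prop) fun x _ => hne' x)
  simp_rw [hpf]
  rw [integral_Icc_eq_integral_Ioc, ← intervalIntegral.integral_of_le (by norm_num),
    intervalIntegral.integral_const_mul, intervalIntegral.integral_add i1 i2,
    integral_inv_add_mul_I hw, integral_inv_sub_mul_I hv]
  have hπ : (π : ℂ) ≠ 0 := by exact_mod_cast Real.pi_ne_zero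
  push_cast
  field_simp
  ring

/-- The arc `A` corresponds to the interval `[-1,1]` under the Möbius transformation. -/
theorem mem_arc_iff {α β : ℝ} (h0 : 0 < β) (h1 : β < π) {θ : Torus}
    (hθ : torusPoint θ ≠ cexp (I * α)) :
    θ ∈ arc α β ↔ (moebiusInv α (Real.tan (β / 2)) (torusPoint θ)).re ∈ Icc (-1 : ℝ) 1 := by
  obtain ⟨t, ht, rfl⟩ : θ ∈ (fun t : ℝ => (t : Torus)) '' Ico α (α + 2 * π) := by
    rw [AddCircle.coe_image_Ico_eq]
    trivial
  have hpt : ∀ t : ℝ, torusPoint (t : Torus) = cexp (I * t) := by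
    intro t
    rw [torusPoint, AddCircle.toCircle_apply_mk, Circle.coe_exp, div_self Real.two_pi_pos.ne',
      one_mul, mul_comm]
  have hne : t ≠ α := by
    rintro rfl
    exact hθ (hpt t)
  have ht1 : α < t := lt_of_le_of_ne ht.1 hne.symm
  have ht2 : t < α + 2 * π := ht.2
  have harc : (t : Torus) ∈ arc α β ↔ t ∈ Icc (α + β) (α + 2 * π - β) := by
    refine ⟨fun ⟨φ, hφ, hφt⟩ => ?_, fun h => ⟨t, h, rfl⟩⟩
    have : φ = t := (AddCircle.coe_eq_coe_iff_of_mem_Ico (p := 2 * π) (a := α)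
      ⟨by linarith [hφ.1], by linarith [hφ.2]⟩ ht).1 hφt
    rwa [← this]
  have hcos : 0 < Real.cos ((t - α - π) / 2) :=
    Real.cos_pos_of_mem_Ioo ⟨by linarith, by linarith⟩
  have hδ := tan_half_pos h0 h1
  have hb : π / 2 - β / 2 ∈ Ioo (-(π / 2)) (π / 2) := ⟨by linarith, by linarith⟩
  have hb' : -(π / 2 - β / 2) ∈ Ioo (-(π / 2)) (π / 2) := ⟨by linarith, by linarith⟩
  have hc : (t - α - π) / 2 ∈ Ioo (-(π / 2)) (π / 2) := ⟨by linarith, by linarith⟩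
  have htan : Real.tan (π / 2 - β / 2) = (Real.tan (β / 2))⁻¹ := Real.tan_pi_div_two_sub _
  have e1 : Real.tan (β / 2) * Real.tan ((t - α - π) / 2) ≤ 1 ↔
      (t - α - π) / 2 ≤ π / 2 - β / 2 := by
    rw [← Real.strictMonoOn_tan.le_iff_le hc hb, htan, ← one_div, le_div_iff₀' hδ]
  have e2 : -1 ≤ Real.tan (β / 2) * Real.tan ((t - α - π) / 2) ↔
      -(π / 2 - β / 2) ≤ (t - α - π) / 2 := by
    rw [← Real.strictMonoOn_tan.le_iff_le hb' hc, Real.tan_neg, htan, neg_le, ← mul_neg,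
      neg_le, ← one_div, le_div_iff₀' hδ]
  rw [harc, moebiusInv_torusPoint hcos.ne', mem_Icc, mem_Icc, e1, e2]
  constructor
  · rintro ⟨h3, h4⟩
    constructor <;> linarith
  · rintro ⟨h3, h4⟩
    constructor <;> linarith

/-- `X` intertwines multiplication by the indicator functions of `[-1,1]` and of the arc `A`. -/
theorem mulOp_arcIndicator_opX {α β : ℝ} (h0 : 0 < β) (h1 : β < π) (f : L2Real) :
    mulOp (arcIndicator α β) (opX α (tan_half_pos h0 h1) f) = opX α (tan_half_pos h0 h1)
      (((Lp.memLp f).indicator (measurableSet_Icc (a := (-1 : ℝ)) (b := 1))).toLp _) := by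
  set δ := Real.tan (β / 2)
  have hδ := tan_half_pos h0 h1
  refine Lp.ext ?_
  filter_upwards [coeFn_mulOp (arcIndicator α β) (opX α hδ f),
    indicatorConstLp_coeFn (p := ∞) (hs := measurableSet_arc α β)
      (hμs := measure_ne_top torusMeasure _) (c := (1 : ℂ)),
    coeFn_weightedComp (measurable_moebiusWeight α δ) (measurable_moebiusInv α δ)
      (moebius_map α hδ) (.refl _ f),
    coeFn_weightedComp (measurable_moebiusWeight α δ) (measurable_moebiusInv α δ)
      (moebius_map α hδ) ((Lp.memLp f).indicator
        (measurableSet_Icc (a := (-1 : ℝ)) (b := 1))).coeFn_toLp,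
    ae_torusPoint_ne (cexp (I * α))] with θ h2 h3 h4 h5 h6
  have hmem := mem_arc_iff h0 h1 h6
  rw [h2, arcIndicator, h3]
  refine Eq.trans ?_ h5.symm
  have h4' : opX α hδ f θ = moebiusWeight α δ (torusPoint θ) *
    f ((moebiusInv α δ (torusPoint θ)).re) := h4
  rw [h4']
  by_cases h : θ ∈ arc α β
  · rw [Set.indicator_of_mem h, Set.indicator_of_mem (hmem.1 h), one_mul]
  · rw [Set.indicator_of_notMem h, Set.indicator_of_notMem (fun h' => h (hmem.2 h')), zero_mul,
      mul_zero]

/-- The matrix elements of the Toeplitz operator between the images of the exponentials. They are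
those of the multiplication operator in `inner_kerLp_mulOp_idUnit`. -/
theorem inner_opXPlus_toeplitz {α β : ℝ} (h0 : 0 < β) (h1 : β < π) (w v : Ioi (0 : ℝ)) :
    inner ℂ (opXPlus α (tan_half_pos h0 h1) (expPos w))
      (toeplitz (arcIndicator α β) (opXPlus α (tan_half_pos h0 h1) (expPos v))) =
      (((1 - (Real.arctan w / π + Real.arctan v / π)) / (w + v) : ℝ) : ℂ) := by
  have hδ := tan_half_pos h0 h1
  have hw : (0 : ℝ) < w := w.2
  have hv : (0 : ℝ) < v := v.2
  have e1 : inner ℂ (opXPlus α hδ (expPos w))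
      (toeplitz (arcIndicator α β) (opXPlus α hδ (expPos v))) =
      inner ℂ (embedPos α hδ (expPos w))
        (mulOp (arcIndicator α β) (embedPos α hδ (expPos v))) := by
    rw [← coe_opXPlus, ← coe_opXPlus]
    exact hardy.inner_orthogonalProjectionOnto_eq_of_mem_left (opXPlus α hδ (expPos w)) _
  set F : Ioi (0 : ℝ) → L2Real := fun w =>
    fourierInv (ContinuousLinearMap.adjoint restrictPos (expPos w)) with hF
  have e2 : mulOp (arcIndicator α β) (embedPos α hδ (expPos v)) = opX α hδ
      (((Lp.memLp (F v)).indicator (measurableSet_Icc (a := (-1 : ℝ)) (b := 1))).toLp _) :=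
    mulOp_arcIndicator_opX h0 h1 (F v)
  have e3 : ∀ f g : L2Real, inner ℂ (opX α hδ f) (opX α hδ g) = inner ℂ f g := fun f g =>
    (weightedComp (measurable_moebiusWeight α _) (measurable_moebiusInv α _)
      (moebius_map α hδ)).inner_map_map f g
  rw [e1, e2]
  change inner ℂ (opX α hδ (F w)) _ = _
  rw [e3, L2.inner_def]
  have e4 : ∀ᵐ x : ℝ, inner ℂ (F w x) (((Lp.memLp (F v)).indicator
      (measurableSet_Icc (a := (-1 : ℝ)) (b := 1))).toLp _ x) =
      (Icc (-1 : ℝ) 1).indicator (fun x : ℝ => (((2 * π)⁻¹ : ℝ) : ℂ) *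
        (((w : ℝ) + x * I : ℂ)⁻¹ * ((v : ℝ) - x * I : ℂ)⁻¹)) x := by
    filter_upwards [((Lp.memLp (F v)).indicator
      (measurableSet_Icc (a := (-1 : ℝ)) (b := 1))).coeFn_toLp, coeFn_fourierInv_expPos w,
      coeFn_fourierInv_expPos v] with x h2 h3 h4
    rw [h2]
    by_cases hx : x ∈ Icc (-1 : ℝ) 1
    · have hsq : (((2 * π)⁻¹ : ℝ) : ℂ) = (((2 * π) ^ (-(1 / 2 : ℝ)) : ℝ) : ℂ) *
          (((2 * π) ^ (-(1 / 2 : ℝ)) : ℝ) : ℂ) := by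
        rw [← ofReal_mul, ← Real.rpow_add Real.two_pi_pos, ← Real.rpow_neg_one]
        norm_num
      rw [Set.indicator_of_mem hx, Set.indicator_of_mem hx, h3, h4, RCLike.inner_apply, map_mul,
        conj_ofReal, map_div₀, map_one, map_sub, map_mul, conj_ofReal, conj_ofReal, conj_I, hsq]
      ring
    · rw [Set.indicator_of_notMem hx, Set.indicator_of_notMem hx, inner_zero_right]
  rw [integral_congr_ae e4, integral_indicator measurableSet_Icc, integral_const_mul,
    integral_inv_mul_inv hw hv, ← ofReal_mul, inv_mul_cancel_left₀ Real.two_pi_pos.ne']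

theorem toeplitz_eq_conj_mulOp {α β : ℝ} (h0 : 0 < β) (h1 : β < π) {V : L2Unit ≃ₗᵢ[ℂ] L2Pos}
    (hV : ∀ w, V (kerLp w) = expPos w) {Y : L2Unit ≃ₗᵢ[ℂ] hardy}
    (hY : ∀ h, Y h = opXPlus α (tan_half_pos h0 h1) (V h)) (g : hardy) :
    toeplitz (arcIndicator α β) g = Y (mulOp idUnit (Y.symm g)) := by
  have hdense := Submodule.dense_iff_topologicalClosure_eq_top.2 topologicalClosure_span_kerLp
  have h : toeplitz (arcIndicator α β) ∘L (Y : L2Unit →L[ℂ] hardy) =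
      (Y : L2Unit →L[ℂ] hardy) ∘L mulOp idUnit := by
    refine ContinuousLinearMap.ext_on hdense ?_
    rintro _ ⟨v, rfl⟩
    change toeplitz (arcIndicator α β) (Y (kerLp v)) = Y (mulOp idUnit (kerLp v))
    rw [← Y.symm_apply_eq, ← sub_eq_zero]
    refine eq_zero_of_inner_kerLp fun w => ?_
    rw [inner_sub_right, inner_kerLp_mulOp_idUnit, ← Y.inner_map_map, Y.apply_symm_apply, hY, hY,
      hV, hV, sub_eq_zero]
    exact inner_opXPlus_toeplitz h0 h1 w v
  have := congrArg (fun T : L2Unit →L[ℂ] hardy => T (Y.symm g)) h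
  simpa using this

/-! ### Generating functions -/

theorem one_add_mul_I_eq_exp (w : ℝ) :
    (1 + w * I : ℂ) = √(1 + w ^ 2) * cexp (Real.arctan w * I) := by
  have h : √(1 + w ^ 2) ≠ 0 := by positivity
  have h1 : √(1 + w ^ 2) * Real.cos (Real.arctan w) = 1 := by
    rw [Real.cos_arctan]
    field_simp
  have h2 : √(1 + w ^ 2) * Real.sin (Real.arctan w) = w := by
    rw [Real.sin_arctan]
    field_simp
  rw [Complex.exp_mul_I, ← Complex.ofReal_cos, ← Complex.ofReal_sin, mul_add, ← mul_assoc,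
    ← ofReal_mul, ← ofReal_mul, h1, h2, ofReal_one]

/-- The polar decomposition of `1 - q exp (-iβ)`, where `q` is the Cayley transform of `w`. -/
theorem one_sub_mul_exp_neg_eq_exp {β w q : ℝ} (h0 : 0 < β) (h1 : β < π) (hq : q < 1)
    (hqw : (1 - q) * w = (1 + q) * Real.tan (β / 2)) :
    1 - q * cexp (-(I * β)) = cexp (Real.log ((1 - q) * Real.cos (β / 2) * √(1 + w ^ 2)) +
      ((Real.arctan w - β / 2 : ℝ) : ℂ) * I) := by
  have hc : 0 < Real.cos (β / 2) := Real.cos_pos_of_mem_Ioo ⟨by linarith, by linarith⟩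
  have hq' : 0 < 1 - q := sub_pos.2 hq
  have e1 : (1 - q) * w * Real.cos (β / 2) = (1 + q) * Real.sin (β / 2) := by
    rw [hqw, mul_assoc, Real.tan_mul_cos hc.ne']
  have e2 : cexp (-(I * β)) = cexp (-((β / 2 : ℝ) : ℂ) * I) * cexp (-((β / 2 : ℝ) : ℂ) * I) := by
    rw [← Complex.exp_add]
    push_cast
    ring_nf
  have e3 : cexp (((β / 2 : ℝ) : ℂ) * I) * cexp (-((β / 2 : ℝ) : ℂ) * I) = 1 := by
    rw [← Complex.exp_add, neg_mul, add_neg_cancel, Complex.exp_zero]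
  have e4 : cexp (((β / 2 : ℝ) : ℂ) * I) = Real.cos (β / 2) + Real.sin (β / 2) * I := by
    rw [Complex.exp_mul_I, ofReal_cos, ofReal_sin]
  have e5 : cexp (-((β / 2 : ℝ) : ℂ) * I) = Real.cos (β / 2) - Real.sin (β / 2) * I := by
    rw [Complex.exp_mul_I, Complex.cos_neg, Complex.sin_neg, ofReal_cos, ofReal_sin]
    ring
  have e6 : ((1 - q) * w * Real.cos (β / 2) : ℂ) = (1 + q) * Real.sin (β / 2) := by
    exact_mod_cast e1
  have e7 : cexp (((Real.arctan w - β / 2 : ℝ) : ℂ) * I) =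
      cexp (Real.arctan w * I) * cexp (-((β / 2 : ℝ) : ℂ) * I) := by
    rw [← Complex.exp_add, ofReal_sub]
    ring_nf
  rw [Complex.exp_add, ← ofReal_exp, Real.exp_log (by positivity), e7]
  calc 1 - q * cexp (-(I * β))
      = (cexp (((β / 2 : ℝ) : ℂ) * I) - q * cexp (-((β / 2 : ℝ) : ℂ) * I)) *
          cexp (-((β / 2 : ℝ) : ℂ) * I) := by rw [e2, sub_mul, e3, mul_assoc]
    _ = ((1 - q) * Real.cos (β / 2) * (1 + w * I)) * cexp (-((β / 2 : ℝ) : ℂ) * I) := by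
        congr 1
        rw [e4, e5]
        linear_combination -I * e6
    _ = _ := by
        rw [one_add_mul_I_eq_exp]
        push_cast
        ring

/-- The generating function of the Meixner-Pollaczek polynomials at the Cayley transform `q` of
`w`. -/
theorem meixnerPollaczek_generating {β w q : ℝ} (h0 : 0 < β) (h1 : β < π) (hw : 0 < w) (hq : q < 1)
    (hqw : (1 - q) * w = (1 + q) * Real.tan (β / 2)) (l : ℝ) :
    (1 - q * cexp (I * β)) ^ (-(1 / 2) + I * l : ℂ) *
      (1 - q * cexp (-(I * β))) ^ (-(1 / 2) - I * l : ℂ) =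
      ((((1 - q) * Real.cos (β / 2) * √(1 + w ^ 2))⁻¹ *
        Real.exp (2 * l * (Real.arctan w - β / 2)) : ℝ) : ℂ) := by
  have hc : 0 < Real.cos (β / 2) := Real.cos_pos_of_mem_Ioo ⟨by linarith, by linarith⟩
  have hq' : 0 < 1 - q := sub_pos.2 hq
  have hR : 0 < (1 - q) * Real.cos (β / 2) * √(1 + w ^ 2) := by positivity
  have e1 := one_sub_mul_exp_neg_eq_exp h0 h1 hq hqw
  have e2 : 1 - q * cexp (I * β) = cexp (Real.log ((1 - q) * Real.cos (β / 2) * √(1 + w ^ 2)) -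
      ((Real.arctan w - β / 2 : ℝ) : ℂ) * I) := by
    have := congrArg (starRingEnd ℂ) e1
    simpa only [map_sub, map_one, map_mul, conj_ofReal, ← Complex.exp_conj, map_neg, conj_I,
      map_add, neg_mul, neg_neg, mul_neg, ← sub_eq_add_neg] using this
  have a1 := Real.arctan_pos.2 hw
  have a2 := Real.arctan_lt_pi_div_two w
  rw [e1, e2, cpow_def_of_ne_zero (Complex.exp_ne_zero _),
    cpow_def_of_ne_zero (Complex.exp_ne_zero _)]
  generalize (1 - q) * Real.cos (β / 2) * √(1 + w ^ 2) = R at hR ⊢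
  generalize hθ : Real.arctan w - β / 2 = θ
  rw [Complex.log_exp (by simp; linarith) (by simp; linarith),
    Complex.log_exp (by simp; linarith) (by simp; linarith), ← Complex.exp_add]
  have hRe : R⁻¹ = Real.exp (-Real.log R) := by rw [Real.exp_neg, Real.exp_log hR]
  rw [hRe, ← Real.exp_add, ofReal_exp]
  congr 1
  push_cast
  linear_combination (-2 * (θ : ℂ) * l) * I_sq

theorem add_mul_one_sub_eq {δ w q : ℝ} (hqw : (1 - q) * w = (1 + q) * δ) :
    (w + δ) * (1 - q) = 2 * δ := by
  linear_combination hqw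

/-- As a function of `q`, the normalized `kerUnit w` is the value of the generating function of the
Meixner-Pollaczek polynomials in `meixnerPollaczek_generating`, times the prefactor of `h_n`. -/
theorem smul_kerUnit_eq {β w q s : ℝ} (h0 : 0 < β) (h1 : β < π) (hq : q < 1)
    (hqw : (1 - q) * w = (1 + q) * Real.tan (β / 2)) (hs : s ∈ Ioo (0 : ℝ) 1) :
    (w + Real.tan (β / 2)) / √(2 * Real.tan (β / 2)) * kerUnit w s =
      √(Real.sin β / π) * (1 / s - 1) ^ (β / (2 * π)) * (1 - s) ^ (-(1 / 2 : ℝ)) *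
        (((1 - q) * Real.cos (β / 2) * √(1 + w ^ 2))⁻¹ *
        Real.exp (2 * (1 / (2 * π) * Real.log (1 / s - 1)) * (Real.arctan w - β / 2))) := by
  have hc : 0 < Real.cos (β / 2) := Real.cos_pos_of_mem_Ioo ⟨by linarith, by linarith⟩
  have hδ := tan_half_pos h0 h1
  have hq' : 0 < 1 - q := sub_pos.2 hq
  have hπ := Real.pi_pos
  have hs0 : 0 < s := hs.1
  have hs1 : 0 < 1 - s := sub_pos.2 hs.2
  have hw2 := add_mul_one_sub_eq hqw
  have hsin : Real.sin β = 2 * Real.tan (β / 2) * Real.cos (β / 2) ^ 2 := by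
    have : Real.sin β = Real.sin (2 * (β / 2)) := by ring_nf
    rw [this, Real.sin_two_mul, ← Real.tan_mul_cos hc.ne']
    ring
  have hbase : (1 : ℝ) / s - 1 = (1 - s) / s := by field_simp
  have hpow : (1 / s - 1) ^ (β / (2 * π)) *
      Real.exp (2 * (1 / (2 * π) * Real.log (1 / s - 1)) * (Real.arctan w - β / 2)) =
      s ^ (-(Real.arctan w / π)) * (1 - s) ^ (Real.arctan w / π) := by
    rw [hbase, Real.rpow_def_of_pos (div_pos hs1 hs0), Real.log_div hs1.ne' hs0.ne',
      Real.rpow_def_of_pos hs0, Real.rpow_def_of_pos hs1, ← Real.exp_add, ← Real.exp_add]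
    congr 1
    field_simp
    ring
  have hsqrt : √(Real.sin β / π) = √(2 * Real.tan (β / 2)) * Real.cos (β / 2) * (√π)⁻¹ := by
    rw [Real.sqrt_div' _ hπ.le, hsin, Real.sqrt_mul (by positivity), Real.sqrt_sq hc.le,
      div_eq_mul_inv]
  have hT : √(2 * Real.tan (β / 2)) * √(2 * Real.tan (β / 2)) = 2 * Real.tan (β / 2) :=
    Real.mul_self_sqrt (by positivity)
  have hker : (1 - s) ^ (Real.arctan w / π - 1 / 2) =
      (1 - s) ^ (Real.arctan w / π) * (1 - s) ^ (-(1 / 2 : ℝ)) := by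
    rw [← Real.rpow_add hs1, ← sub_eq_add_neg]
  have hfac : (w + Real.tan (β / 2)) / √(2 * Real.tan (β / 2)) =
      √(2 * Real.tan (β / 2)) * (1 - q)⁻¹ := by
    have : √(2 * Real.tan (β / 2)) ≠ 0 := by positivity
    rw [div_eq_iff this, mul_right_comm, hT, ← hw2]
    field_simp
  calc _ = √(2 * Real.tan (β / 2)) * (1 - q)⁻¹ * ((√π)⁻¹ * (√(1 + w ^ 2))⁻¹) *
        (1 - s) ^ (-(1 / 2 : ℝ)) *
        (s ^ (-(Real.arctan w / π)) * (1 - s) ^ (Real.arctan w / π)) := by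
        rw [hfac, kerUnit, hker]
        ring
    _ = _ := by
        rw [← hpow, hsqrt]
        field_simp

theorem taylorCoeff_const_mul (c : ℂ) (f : ℂ → ℂ) (n : ℕ) :
    taylorCoeff (fun q => c * f q) n = c * taylorCoeff f n := by
  rw [taylorCoeff, taylorCoeff, iteratedDeriv_const_mul_field, mul_div_assoc]

theorem analyticAt_meixnerPollaczek_generating (β : ℝ) (a b : ℂ) :
    AnalyticAt ℂ (fun q : ℂ => (1 - q * cexp (I * β)) ^ a * (1 - q * cexp (-(I * β))) ^ b) 0 := by
  refine AnalyticAt.mul (AnalyticAt.cpow ?_ analyticAt_const (by simp))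
    (AnalyticAt.cpow ?_ analyticAt_const (by simp))
  · exact analyticAt_const.sub (analyticAt_id.mul analyticAt_const)
  · exact analyticAt_const.sub (analyticAt_id.mul analyticAt_const)

theorem analyticAt_laguerre_generating (x : ℝ) :
    AnalyticAt ℂ (fun q : ℂ => (1 - q)⁻¹ * cexp (-(1 / 2) * ((1 + q) / (1 - q)) * x)) 0 := by
  have h : AnalyticAt ℂ (fun q : ℂ => 1 - q) 0 := analyticAt_const.sub analyticAt_id
  refine (h.inv (by simp)).mul (AnalyticAt.cexp ?_)
  exact (analyticAt_const.mul ((analyticAt_const.add analyticAt_id).div h (by simp))).mul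
    analyticAt_const

theorem one_div_add_two_lt_one (k : ℕ) : 1 / ((k : ℝ) + 2) < 1 := by
  rw [div_lt_one (by positivity)]
  linarith [Nat.cast_nonneg (α := ℝ) k]

theorem one_sub_mul_cayleySeq {δ : ℝ} (hδ : 0 < δ) (k : ℕ) :
    (1 - 1 / ((k : ℝ) + 2)) * cayleySeq hδ k = (1 + 1 / ((k : ℝ) + 2)) * δ := by
  rw [cayleySeq, mul_div_cancel₀ _ (sub_pos.2 (one_div_add_two_lt_one k)).ne', mul_comm]

/-! ### The preimages of the standard basis of the Hardy space -/

theorem norm_hardyBasis (n : ℕ) : ‖hardyBasis n‖ = 1 :=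
  orthonormal_fourier.1 (n : ℤ)

theorem orthonormal_hardyBasis : Orthonormal ℂ hardyBasis := by
  have h := orthonormal_fourier (T := 2 * π).comp (fun n : ℕ => (n : ℤ)) Nat.cast_injective
  exact ⟨norm_hardyBasis, fun _ _ hij => h.2 hij⟩

/-- The functions `h_n` are the preimages of the `e_n`, because the generating function of the
latter is the image of the `kerUnit w` under the isomorphism. -/
theorem symm_hardyBasis_ae_eq_mpFun (α : ℝ) {β : ℝ} (h0 : 0 < β) (h1 : β < π)
    {Y : L2Unit ≃ₗᵢ[ℂ] hardy}
    (hY : ∀ w, Y (kerLp w) = opXPlus α (tan_half_pos h0 h1) (expPos w)) (n : ℕ) :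
    Y.symm (hardyBasis n) =ᵐ[volume.restrict (Ioo (0 : ℝ) 1)] mpFun α β n := by
  have hδ := tan_half_pos h0 h1
  have h := ae_eq_taylorCoeff (g := fun n => cexp (-(I * α)) ^ n • Y.symm (hardyBasis n))
    (F := fun s q => ((√(Real.sin β / π) * (1 / s - 1) ^ (β / (2 * π)) *
      (1 - s) ^ (-(1 / 2 : ℝ)) : ℝ) : ℂ) *
      ((1 - q * cexp (I * β)) ^
        (-(1 / 2) + I * ((1 / (2 * π) * Real.log (1 / s - 1) : ℝ) : ℂ) : ℂ) *
      (1 - q * cexp (-(I * β))) ^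
        (-(1 / 2) - I * ((1 / (2 * π) * Real.log (1 / s - 1) : ℝ) : ℂ) : ℂ)))
    (G := fun k => (((cayleySeq hδ k + Real.tan (β / 2)) / √(2 * Real.tan (β / 2)) : ℝ) : ℂ) •
      kerLp (cayleySeq hδ k))
    (fun n => by
      rw [norm_smul, norm_pow, LinearIsometryEquiv.norm_map, norm_hardyBasis, Complex.norm_exp]
      simp) tendsto_one_div_add_two
    (.of_forall fun k => by
      have h2 := (Y.symm : hardy →L[ℂ] L2Unit).hasSum
        (hasSum_opXPlus_expPos α hδ (cayleySeq hδ k))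
      simp only [map_smul, cayleySeq_sub_div_add, mul_pow, ← hY] at h2
      simpa [smul_smul] using h2)
    (.of_forall fun k => by
      filter_upwards [Lp.coeFn_smul
        (((cayleySeq hδ k + Real.tan (β / 2)) / √(2 * Real.tan (β / 2)) : ℝ) : ℂ)
        (kerLp (cayleySeq hδ k)), (memLp_kerUnit (cayleySeq hδ k).2).coeFn_toLp,
        ae_restrict_mem measurableSet_Ioo] with s h2 h3 hs
      rw [h2, Pi.smul_apply, kerLp, h3, smul_eq_mul, ← ofReal_mul,
        smul_kerUnit_eq h0 h1 (one_div_add_two_lt_one k) (one_sub_mul_cayleySeq hδ k) hs,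
        ofReal_mul, ← meixnerPollaczek_generating h0 h1 (cayleySeq hδ k).2
          (one_div_add_two_lt_one k) (one_sub_mul_cayleySeq hδ k)])
    (.of_forall fun s => analyticAt_const.mul (analyticAt_meixnerPollaczek_generating β _ _)) n
  filter_upwards [h, Lp.coeFn_smul (cexp (-(I * α)) ^ n) (Y.symm (hardyBasis n))] with s h2 h3
  rw [h3, Pi.smul_apply, smul_eq_mul, taylorCoeff_const_mul] at h2
  have h4 : cexp (I * n * α) * cexp (-(I * α)) ^ n = 1 := by
    rw [← Complex.exp_nat_mul, ← Complex.exp_add]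
    ring_nf
    exact Complex.exp_zero
  rw [mpFun, meixnerPollaczek, mul_assoc, ← h2, ← mul_assoc, h4, one_mul]

/-- For `δ = 1/2` the exponentials are the values of the generating function of the Laguerre
functions at `q = (w - δ) / (w + δ)`. -/
theorem symm_hardyBasis_ae_eq_laguerreFun {δ : ℝ} (hδ : 0 < δ) (hδ2 : δ = 1 / 2)
    {Φ : L2Pos ≃ₗᵢ[ℂ] hardy} (hΦ : ∀ f, Φ f = opXPlus 0 hδ f) (n : ℕ) :
    Φ.symm (hardyBasis n) =ᵐ[volume.restrict (Ioi (0 : ℝ))] laguerreFun n := by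
  refine ae_eq_taylorCoeff (g := fun n => Φ.symm (hardyBasis n))
    (F := fun x q => (1 - q)⁻¹ * cexp (-(1 / 2) * ((1 + q) / (1 - q)) * x))
    (G := fun k => (((cayleySeq hδ k + δ) / √(2 * δ) : ℝ) : ℂ) • expPos (cayleySeq hδ k))
    (fun n => by rw [LinearIsometryEquiv.norm_map, norm_hardyBasis]) tendsto_one_div_add_two
    (.of_forall fun k => by
      have h2 := (Φ.symm : hardy →L[ℂ] L2Pos).hasSum
        (hasSum_opXPlus_expPos 0 hδ (cayleySeq hδ k))
      simp only [map_smul, cayleySeq_sub_div_add, mul_pow, ← hΦ] at h2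
      simpa using h2)
    (.of_forall fun k => ?_) (.of_forall fun x => analyticAt_laguerre_generating x) n
  filter_upwards [Lp.coeFn_smul (((cayleySeq hδ k + δ) / √(2 * δ) : ℝ) : ℂ)
    (expPos (cayleySeq hδ k)), (memLp_exp_neg (cayleySeq hδ k).2).coeFn_toLp] with x h2 h3
  have hq := sub_pos.2 (one_div_add_two_lt_one k)
  have hw := one_sub_mul_cayleySeq hδ k
  have hw2 := add_mul_one_sub_eq hw
  rw [h2, Pi.smul_apply, expPos, h3, smul_eq_mul]
  clear h2 h3
  generalize (cayleySeq hδ k : ℝ) = w at *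
  generalize 1 / ((k : ℝ) + 2) = q at *
  subst hδ2
  have e1 : (w + 1 / 2) / √(2 * (1 / 2)) = (1 - q)⁻¹ := by
    norm_num at hw2 ⊢
    exact eq_inv_of_mul_eq_one_left hw2
  have e2 : w = 1 / 2 * ((1 + q) / (1 - q)) := by
    field_simp
    linarith
  rw [e1, e2, ofReal_exp]
  push_cast
  ring_nf

theorem mainTheorem8 :
    ∃ V : L2Unit ≃ₗᵢ[ℂ] L2Pos,
      (∀ h : L2Unit, IsTransformV h (V h)) ∧
      (∀ (α β : ℝ) (_ : 0 ≤ α) (_ : α < 2 * π) (hβ₀ : 0 < β) (hβ₁ : β < π),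
        ∃ Y : L2Unit ≃ₗᵢ[ℂ] hardy,
          (∀ h : L2Unit, Y h = opXPlus α (tan_half_pos hβ₀ hβ₁) (V h)) ∧
          (∀ g : hardy, toeplitz (arcIndicator α β) g = Y (mulOp idUnit (Y.symm g))) ∧
          ∃ hmem : ∀ n : ℕ, MemLp (mpFun α β n) 2 (volume.restrict (Ioo (0 : ℝ) 1)),
            Orthonormal ℂ (fun n : ℕ => (hmem n).toLp (mpFun α β n)) ∧
            (Submodule.span ℂ
              (range fun n : ℕ => (hmem n).toLp (mpFun α β n))).topologicalClosure = ⊤ ∧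
            ∀ n : ℕ, Y.symm (hardyBasis n) = (hmem n).toLp (mpFun α β n)) ∧
      (∀ β : ℝ, 0 < β → β < π → Real.tan (β / 2) = 1 / 2 →
        ∃ (lmem : ∀ n : ℕ, MemLp (laguerreFun n) 2 (volume.restrict (Ioi (0 : ℝ))))
          (hmem : ∀ n : ℕ, MemLp (mpFun 0 β n) 2 (volume.restrict (Ioo (0 : ℝ) 1))),
          ∀ n : ℕ, V.symm ((lmem n).toLp (laguerreFun n)) = (hmem n).toLp (mpFun 0 β n)) := by
  obtain ⟨V, hV⟩ := exists_linearIsometryEquiv_of_inner_eq topologicalClosure_span_kerLp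
    topologicalClosure_span_expPos fun w v =>
      (inner_kerLp_kerLp w v).trans (inner_expPos_expPos w v).symm
  refine ⟨V, isTransformV_apply hV, fun α β _ _ h0 h1 => ?_, fun β h0 h1 hβ => ?_⟩
  · obtain ⟨Φ, hΦ⟩ := exists_linearIsometryEquiv_opXPlus α (tan_half_pos h0 h1)
    have hY : ∀ h, V.trans Φ h = opXPlus α (tan_half_pos h0 h1) (V h) := fun h => hΦ (V h)
    have hae := symm_hardyBasis_ae_eq_mpFun α h0 h1 (Y := V.trans Φ) fun w => by rw [hY, hV]
    have hmem : ∀ n, MemLp (mpFun α β n) 2 (volume.restrict (Ioo (0 : ℝ) 1)) := fun n =>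
      (memLp_congr_ae (hae n)).1 (Lp.memLp _)
    have heq : ∀ n, (V.trans Φ).symm (hardyBasis n) = (hmem n).toLp (mpFun α β n) := fun n =>
      Lp.ext ((hae n).trans (hmem n).coeFn_toLp.symm)
    refine ⟨V.trans Φ, hY, toeplitz_eq_conj_mulOp h0 h1 hV hY, hmem, ?_, ?_, heq⟩
    · simp_rw [← heq]
      exact orthonormal_hardyBasis.comp_linearIsometryEquiv (V.trans Φ).symm
    · refine topologicalClosure_span_eq_top_of_inner_eq_zero fun f hf => ?_
      refine (V.trans Φ).map_eq_zero_iff.1 (eq_zero_of_inner_hardyBasis fun n => ?_)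
      rw [← hf n, ← heq n, ← (V.trans Φ).inner_map_map, LinearIsometryEquiv.apply_symm_apply]
  · obtain ⟨Φ, hΦ⟩ := exists_linearIsometryEquiv_opXPlus 0 (tan_half_pos h0 h1)
    have hae := symm_hardyBasis_ae_eq_mpFun 0 h0 h1 (Y := V.trans Φ) fun w => by
      rw [← hV]; exact hΦ _
    have hael := symm_hardyBasis_ae_eq_laguerreFun (tan_half_pos h0 h1) hβ hΦ
    have hmem : ∀ n, MemLp (mpFun 0 β n) 2 (volume.restrict (Ioo (0 : ℝ) 1)) := fun n =>
      (memLp_congr_ae (hae n)).1 (Lp.memLp _)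
    have lmem : ∀ n, MemLp (laguerreFun n) 2 (volume.restrict (Ioi (0 : ℝ))) := fun n =>
      (memLp_congr_ae (hael n)).1 (Lp.memLp _)
    refine ⟨lmem, hmem, fun n => ?_⟩
    have e1 : (lmem n).toLp (laguerreFun n) = Φ.symm (hardyBasis n) :=
      Lp.ext ((lmem n).coeFn_toLp.trans (hael n).symm)
    rw [e1]
    exact Lp.ext ((hae n).trans (hmem n).coeFn_toLp.symm)
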